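/- Let $\kappa_1,\kappa_2,\alpha,\beta,\gamma,s_0>0$ and $p\ge 1$ be constants, and put $f(u,v)=\beta(\gamma v-u)$ and $\psi(r)=\alpha\,(\max\{r,0\})^p$. Let $g_*,h_*>0$ with $\gamma h_*=g_*$, let $g\equiv g_*$ and $h\equiv h_*$ on $[0,\infty)$, and let $u_0,v_0\in L^\infty(0,s_0)$ be nonnegative. Consider the carbonation problem P of finding $s,u,v$ with $$u_t-\kappa_1u_{xx}=f(u,v),\qquad v_t-\kappa_2v_{xx}=-f(u,v)\qquad\text{for } t>0,\ 0<x<s(t),$$ $$u(t,0)=g(t),\quad v(t,0)=h(t),\quad s'(t)=\psi(u(t,s(t))),$$ $$-\kappa_1u_x(t,s(t))=\psi(u(t,s(t)))+s'(t)u(t,s(t)),\qquad -\kappa_2v_x(t,s(t))=s'(t)v(t,s(t)),$$ $$s(0)=s_0,\quad u(0,\cdot)=u_0,\quad v(0,\cdot)=v_0\ \text{ on }(0,s_0).$$ Weak solutions are defined as follows. Let $H=L^2(0,1)$ and $X=\{z\in H^1(0,1):z(0)=0\}$ with dual $X^*$, where $H$ is mapped into $X^*$ through the inner product of $H$. Let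 $Q(T)=(0,T)\times(0,1)$, $V(T)=L^\infty(0,T;H)\cap L^2(0,T;H^1(0,1))$ and $V_0(T)=V(T)\cap L^2(0,T;X)$, and write $\bar u(t,y)=u(t,s(t)y)$, $\bar v(t,y)=v(t,s(t)y)$. The triplet $\{s,u,v\}$ is a weak solution of P on $[0,T]$ if: (S1) $s\in W^{1,\infty}(0,T)$, $s>0$ on $[0,T]$, and $\bar u,\bar v\in W^{1,2}(0,T;X^*)\cap V(T)\cap L^\infty(Q(T))$; (S2) $\bar u-g,\ \bar v-h\in L^2(0,T;X)$, and $\bar u(0,y)=u_0(s_0y)$, $\bar v(0,y)=v_0(s_0y)$ for a.e. $y\in(0,1)$; (S3) $s'(t)=\psi(\bar u(t,1))$ for a.e. $t\in(0,T)$, and $s(0)=s_0$; (S4) for all $z\in V_0(T)$, $$\int_0^T\langle\bar u_t,z\rangle_X\,dt+\int_{Q(T)}\frac{\kappa_1}{s^2}\bar u_yz_y\,dy\,dt+\int_0^T\frac{s'}{s}(\bar u(\cdot,1)+1)z(\cdot,1)\,dt=\int_{Q(T)}\Big(f(\bar u,\bar v)+\frac{s'}{s}y\bar u_y\Big)z\,dy\,dt;$$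 (S5) for all $z\in V_0(T)$, $$\int_0^T\langle\bar v_t,z\rangle_X\,dt+\int_{Q(T)}\frac{\kappa_2}{s^2}\bar v_yz_y\,dy\,dt+\int_0^T\frac{s'}{s}\bar v(\cdot,1)z(\cdot,1)\,dt=\int_{Q(T)}\Big(-f(\bar u,\bar v)+\frac{s'}{s}y\bar v_y\Big)z\,dy\,dt.$$ It is a weak solution of P on $[0,\infty)$ if it is a weak solution on $[0,T]$ for every $T>0$. Theorem. There is a constant $c>0$, depending only on the data $\kappa_1,\kappa_2,\alpha,\beta,\gamma,p,s_0,u_0,v_0,g_*,h_*$, such that every weak solution $\{s,u,v\}$ of P on $[0,\infty)$ satisfies $$s(t)\ge c\sqrt t\qquad\text{for all } t\ge 0.$$ -/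

import Mathlib

open MeasureTheory Set Filter
open scoped ContDiff

namespace Carbonation

noncomputable section

/-! ### The function spaces `H = L²(0,1)`, `H¹(0,1)`, `X` and `X*` -/

/-- Lebesgue measure on the interval `(0, T)`. -/
abbrev vol (T : ℝ) : Measure ℝ := volume.restrict (Ioo 0 T)

/-- The Hilbert space `H = L²(0,1)`. -/
abbrev H : Type := Lp ℝ 2 (vol 1)

/-- Smooth functions whose support is a compact subset of `(0,1)`. -/
def IsTest (φ : ℝ → ℝ) : Prop :=
  ContDiff ℝ ∞ φ ∧ HasCompactSupport φ ∧ tsupport φ ⊆ Ioo 0 1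

/-- `w` is the weak derivative of `z` on `(0,1)`. -/
def IsWeakDeriv (z w : H) : Prop :=
  ∀ φ : ℝ → ℝ, IsTest φ →
    ∫ y in Ioo (0 : ℝ) 1, z y * deriv φ y = -∫ y in Ioo (0 : ℝ) 1, w y * φ y

theorem integrable_H (z : H) : Integrable z (vol 1) :=
  (Lp.memLp z).integrable (by norm_num)

theorem integrable_mul (z : H) {φ : ℝ → ℝ} (hc : Continuous φ) (hs : HasCompactSupport φ) :
    Integrable (fun y => z y * φ y) (vol 1) := by
  obtain ⟨C, hC⟩ := hs.exists_bound_of_continuous hc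
  exact (integrable_H z).mul_bdd hc.aestronglyMeasurable (Eventually.of_forall hC)

theorem IsTest.deriv_continuous {φ : ℝ → ℝ} (h : IsTest φ) : Continuous (deriv φ) :=
  h.1.continuous_deriv (by simp)

/-- `H¹(0,1)`, as the space of the pairs `(z, z_y)` in `L²(0,1) × L²(0,1)` where `z_y` is the weak
derivative of `z`. It carries the norm `(|z|² + |z_y|²)^{1/2}` and the corresponding inner
product. -/
def H1 : Submodule ℝ (WithLp 2 (H × H)) where
  carrier := {q | IsWeakDeriv q.fst q.snd}
  zero_mem' := by
    intro φ _
    have h0 : ((0 : H) : ℝ → ℝ) =ᵐ[vol 1] 0 := Lp.coeFn_zero _ _ _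
    have e1 : ∫ y in Ioo (0 : ℝ) 1, (0 : H) y * deriv φ y = 0 := by
      exact integral_eq_zero_of_ae (h0.mono fun y hy => by simp only [hy, Pi.zero_apply, zero_mul])
    have e2 : ∫ y in Ioo (0 : ℝ) 1, (0 : H) y * φ y = 0 := by
      exact integral_eq_zero_of_ae (h0.mono fun y hy => by simp only [hy, Pi.zero_apply, zero_mul])
    change ∫ y in Ioo (0 : ℝ) 1, (0 : H) y * deriv φ y = -∫ y in Ioo (0 : ℝ) 1, (0 : H) y * φ y
    rw [e1, e2, neg_zero]
  add_mem' := by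
    intro a b ha hb φ hφ
    have key : ∀ (x z : H) (η : ℝ → ℝ), Continuous η → HasCompactSupport η →
        ∫ y in Ioo (0 : ℝ) 1, (x + z : H) y * η y
          = (∫ y in Ioo (0 : ℝ) 1, x y * η y) + ∫ y in Ioo (0 : ℝ) 1, z y * η y := by
      intro x z η hc hs
      rw [← integral_add (integrable_mul x hc hs) (integrable_mul z hc hs)]
      exact integral_congr_ae ((Lp.coeFn_add x z).mono fun y hy => by
        simp only [hy, Pi.add_apply]; ring)
    have h1 := ha φ hφ
    have h2 := hb φ hφ
    change ∫ y in Ioo (0 : ℝ) 1, (a.fst + b.fst : H) y * deriv φ y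
      = -∫ y in Ioo (0 : ℝ) 1, (a.snd + b.snd : H) y * φ y
    rw [key _ _ _ hφ.deriv_continuous hφ.2.1.deriv, key _ _ _ hφ.1.continuous hφ.2.1, h1, h2]
    ring
  smul_mem' := by
    intro c a ha φ hφ
    have key : ∀ (x : H) (η : ℝ → ℝ),
        ∫ y in Ioo (0 : ℝ) 1, (c • x : H) y * η y = c * ∫ y in Ioo (0 : ℝ) 1, x y * η y := by
      intro x η
      rw [← integral_const_mul]
      exact integral_congr_ae ((Lp.coeFn_smul c x).mono fun y hy => by
        simp only [hy, Pi.smul_apply, smul_eq_mul]; ring)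
    have h1 := ha φ hφ
    change ∫ y in Ioo (0 : ℝ) 1, (c • a.fst : H) y * deriv φ y
      = -∫ y in Ioo (0 : ℝ) 1, (c • a.snd : H) y * φ y
    rw [key, key, h1]
    ring

/-- The embedding of `H¹(0,1)` into `L²(0,1)`. -/
def H1.toH : H1 →L[ℝ] H := (WithLp.fstL 2 ℝ H H).comp H1.subtypeL

/-- The weak derivative `z_y` of `z` in `H¹(0,1)`. -/
def H1.dy : H1 →L[ℝ] H := (WithLp.sndL 2 ℝ H H).comp H1.subtypeL

theorem H1.isWeakDeriv (z : H1) : IsWeakDeriv (H1.toH z) (H1.dy z) := z.2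

/-- A smooth function that is supported in `(0,1)` and has integral zero is the derivative of
such a function. -/
theorem exists_test_primitive {ψ : ℝ → ℝ} (hψ : IsTest ψ) (h0 : ∫ y, ψ y = 0) :
    ∃ φ, IsTest φ ∧ deriv φ = ψ := by
  have hcont : Continuous ψ := hψ.1.continuous
  have hd : ∀ x, HasDerivAt (fun y => ∫ x in (0 : ℝ)..y, ψ x) (ψ x) x := fun x =>
    intervalIntegral.integral_hasDerivAt_right (hcont.intervalIntegrable _ _)
      (hcont.stronglyMeasurableAtFilter _ _) hcont.continuousAt
  have hder : deriv (fun y => ∫ x in (0 : ℝ)..y, ψ x) = ψ := funext fun x => (hd x).deriv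
  obtain ⟨a, b, ha, hb, hK⟩ : ∃ a b : ℝ, 0 < a ∧ b < 1 ∧ tsupport ψ ⊆ Icc a b := by
    rcases (tsupport ψ).eq_empty_or_nonempty with he | hne
    · exact ⟨1 / 2, 1 / 2, by norm_num, by norm_num, by simp [he]⟩
    · have hcp : IsCompact (tsupport ψ) := hψ.2.1
      obtain ⟨a, haK, ha⟩ := hcp.exists_isLeast hne
      obtain ⟨b, hbK, hb⟩ := hcp.exists_isGreatest hne
      exact ⟨a, b, (hψ.2.2 haK).1, (hψ.2.2 hbK).2, fun x hx => ⟨ha hx, hb hx⟩⟩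
  have hz : ∀ x, x ∉ Icc a b → ψ x = 0 := fun x hx =>
    image_eq_zero_of_notMem_tsupport fun h => hx (hK h)
  have hleft : ∀ y, y < a → ∫ x in (0 : ℝ)..y, ψ x = 0 := by
    intro y hy
    refine (intervalIntegral.integral_congr (g := fun _ => (0 : ℝ)) fun x hx => ?_).trans (by simp)
    refine hz x fun h => ?_
    have := hx.2
    have h3 : max 0 y < a := max_lt ha hy
    have h4 := h.1
    linarith
  have hright : ∀ y, b < y → ∫ x in (0 : ℝ)..y, ψ x = 0 := by
    intro y hy
    rcases lt_or_ge y a with h | h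
    · exact hleft y h
    rw [intervalIntegral.integral_of_le (ha.le.trans h)]
    refine Eq.trans ?_ h0
    refine setIntegral_eq_integral_of_forall_compl_eq_zero fun x hx => hz x fun h' => hx ?_
    exact ⟨ha.trans_le h'.1, h'.2.trans hy.le⟩
  have hsupp : tsupport (fun y => ∫ x in (0 : ℝ)..y, ψ x) ⊆ Icc a b := by
    refine closure_minimal (fun y hy => ?_) isClosed_Icc
    by_contra hn
    rw [mem_Icc, not_and_or, not_le, not_le] at hn
    exact hy (hn.elim (hleft y) (hright y))
  refine ⟨_, ⟨?_, ?_, ?_⟩, hder⟩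
  · rw [contDiff_infty_iff_deriv, hder]
    exact ⟨fun x => (hd x).differentiableAt, hψ.1⟩
  · exact isCompact_Icc.of_isClosed_subset (isClosed_tsupport _) hsupp
  · exact hsupp.trans (Icc_subset_Ioo ha hb)

/-- Every element of `H¹(0,1)` has a representative that is continuous on `[0,1]`. -/
theorem H1.exists_rep (z : H1) :
    ∃ f : ℝ → ℝ, ContinuousOn f (Icc 0 1) ∧ H1.toH z =ᵐ[vol 1] f := by
  have hwi : IntervalIntegrable (H1.dy z) volume 0 1 := by
    rw [intervalIntegrable_iff_integrableOn_Ioo_of_le zero_le_one]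
    exact integrable_H _
  have hAC := hwi.absolutelyContinuousOnInterval_intervalIntegral (c := 0) (by simp)
  set W : ℝ → ℝ := fun y => ∫ x in (0 : ℝ)..y, H1.dy z x with hW
  have hWc : ContinuousOn W (Icc 0 1) := by simpa using hAC.continuousOn
  have hWI : Integrable W (vol 1) :=
    (hWc.integrableOn_Icc).mono_set Ioo_subset_Icc_self
  have hWd : ∀ᵐ x, x ∈ uIcc (0 : ℝ) 1 → deriv W x = H1.dy z x := by
    filter_upwards [hwi.ae_hasDerivAt_integral] with x hx hx'
    exact (hx hx' 0 (by simp)).deriv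
  -- integration by parts for the primitive
  have hparts : ∀ φ, IsTest φ →
      ∫ y in Ioo (0 : ℝ) 1, W y * deriv φ y = -∫ y in Ioo (0 : ℝ) 1, H1.dy z y * φ y := by
    intro φ hφ
    have hφAC : AbsolutelyContinuousOnInterval φ 0 1 :=
      ((hφ.1.of_le (by simp)).contDiffOn).absolutelyContinuousOnInterval
    have h := hAC.integral_mul_deriv_eq_deriv_mul hφAC
    have hφ0 : φ 0 = 0 := image_eq_zero_of_notMem_tsupport fun h => by simpa using hφ.2.2 h
    have hφ1 : φ 1 = 0 := image_eq_zero_of_notMem_tsupport fun h => by simpa using hφ.2.2 h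
    rw [hφ0, hφ1, mul_zero, mul_zero, sub_zero, zero_sub] at h
    have h2 : ∫ x in (0 : ℝ)..1, deriv W x * φ x = ∫ x in (0 : ℝ)..1, H1.dy z x * φ x := by
      refine intervalIntegral.integral_congr_ae ?_
      filter_upwards [hWd] with x hx hx'
      rw [hx (uIoc_subset_uIcc hx')]
    rw [h2] at h
    simpa only [intervalIntegral.integral_of_le zero_le_one, integral_Ioc_eq_integral_Ioo] using h
  set D : ℝ → ℝ := fun y => H1.toH z y - W y with hD
  have hDI : Integrable D (vol 1) := (integrable_H _).sub hWI
  have hDmul : ∀ φ : ℝ → ℝ, Continuous φ → HasCompactSupport φ →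
      Integrable (fun y => D y * φ y) (vol 1) := by
    intro φ hc hs
    obtain ⟨C, hC⟩ := hs.exists_bound_of_continuous hc
    exact hDI.mul_bdd hc.aestronglyMeasurable (Eventually.of_forall hC)
  have hDφ : ∀ φ, IsTest φ → ∫ y in Ioo (0 : ℝ) 1, D y * deriv φ y = 0 := by
    intro φ hφ
    have hWm : Integrable (fun y => W y * deriv φ y) (vol 1) := by
      obtain ⟨C, hC⟩ := hφ.2.1.deriv.exists_bound_of_continuous hφ.deriv_continuous
      exact hWI.mul_bdd hφ.deriv_continuous.aestronglyMeasurable (Eventually.of_forall hC)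
    simp only [hD, sub_mul]
    rw [integral_sub (integrable_mul _ hφ.deriv_continuous hφ.2.1.deriv) hWm, hparts φ hφ,
      H1.isWeakDeriv z φ hφ, sub_self]
  -- a fixed test function of integral one
  let ρ : ContDiffBump (1 / 2 : ℝ) := ⟨1 / 8, 1 / 4, by norm_num, by norm_num⟩
  set r : ℝ → ℝ := ρ.normed volume with hr
  have hrs : tsupport r ⊆ Ioo 0 1 := by
    rw [hr, ρ.tsupport_normed_eq, Real.closedBall_eq_Icc]
    exact Icc_subset_Ioo (by norm_num [ρ]) (by norm_num [ρ])
  have hrT : IsTest r := ⟨ρ.contDiff_normed, ρ.hasCompactSupport_normed, hrs⟩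
  set c : ℝ := ∫ y in Ioo (0 : ℝ) 1, D y * r y with hc
  have hset : ∀ ψ : ℝ → ℝ, tsupport ψ ⊆ Ioo 0 1 → ∫ y in Ioo (0 : ℝ) 1, ψ y = ∫ y, ψ y := by
    intro ψ hψ
    exact setIntegral_eq_integral_of_forall_compl_eq_zero fun x hx =>
      image_eq_zero_of_notMem_tsupport fun h => hx (hψ h)
  have hfin : ∀ ψ, IsTest ψ → ∫ y in Ioo (0 : ℝ) 1, (D y - c) * ψ y = 0 := by
    intro ψ hψ
    have hψi : Integrable ψ := hψ.1.continuous.integrable_of_hasCompactSupport hψ.2.1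
    have hri : Integrable r := hrT.1.continuous.integrable_of_hasCompactSupport hrT.2.1
    set m : ℝ := ∫ y, ψ y with hm
    have hχs : tsupport (fun y => ψ y - m * r y) ⊆ tsupport ψ ∪ tsupport r := by
      refine closure_minimal (fun y hy => ?_) ((isClosed_tsupport _).union (isClosed_tsupport _))
      by_contra hn
      rw [mem_union, not_or] at hn
      refine hy ?_
      simp [image_eq_zero_of_notMem_tsupport hn.1, image_eq_zero_of_notMem_tsupport hn.2]
    have hχ : IsTest (fun y => ψ y - m * r y) :=
      ⟨hψ.1.sub (contDiff_const.mul hrT.1),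
        (IsCompact.union hψ.2.1 hrT.2.1).of_isClosed_subset (isClosed_tsupport _) hχs,
        hχs.trans (union_subset hψ.2.2 hrT.2.2)⟩
    have hχ0 : ∫ y, (ψ y - m * r y) = 0 := by
      rw [integral_sub hψi (hri.const_mul m), integral_const_mul, hr, ρ.integral_normed]
      simp [hm]
    obtain ⟨φ, hφ, hφd⟩ := exists_test_primitive hχ hχ0
    have h := hDφ φ hφ
    rw [hφd] at h
    have h1 : ∫ y in Ioo (0 : ℝ) 1, D y * (ψ y - m * r y)
        = (∫ y in Ioo (0 : ℝ) 1, D y * ψ y) - m * c := by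
      rw [hc, ← integral_const_mul,
        ← integral_sub (hDmul ψ hψ.1.continuous hψ.2.1)
          ((hDmul r hrT.1.continuous hrT.2.1).const_mul m)]
      exact integral_congr_ae (Eventually.of_forall fun y => by ring)
    have h2 : ∫ y in Ioo (0 : ℝ) 1, (D y - c) * ψ y
        = (∫ y in Ioo (0 : ℝ) 1, D y * ψ y) - c * m := by
      rw [hm, ← hset ψ hψ.2.2, ← integral_const_mul,
        ← integral_sub (hDmul ψ hψ.1.continuous hψ.2.1) (hψi.restrict.const_mul c)]
      exact integral_congr_ae (Eventually.of_forall fun y => by ring)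
    linarith
  have hae : ∀ᵐ x, x ∈ Ioo (0 : ℝ) 1 → D x - c = 0 := by
    refine isOpen_Ioo.ae_eq_zero_of_integral_contDiff_smul_eq_zero ?_ ?_
    · have hDc : IntegrableOn (fun x => D x - c) (Ioo (0 : ℝ) 1) :=
        hDI.sub (integrable_const c)
      exact hDc.locallyIntegrableOn
    · intro g hg hgc hgs
      have h := hfin g ⟨hg, hgc, hgs⟩
      rw [← h, ← setIntegral_eq_integral_of_forall_compl_eq_zero (s := Ioo (0 : ℝ) 1)]
      · exact integral_congr_ae (Eventually.of_forall fun y => by simp [mul_comm])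
      · intro x hx
        rw [image_eq_zero_of_notMem_tsupport fun h => hx (hgs h), zero_smul]
  refine ⟨fun y => W y + c, hWc.add continuousOn_const, ?_⟩
  rw [EventuallyEq, ae_restrict_iff' measurableSet_Ioo]
  filter_upwards [hae] with x hx hx'
  have h := hx hx'
  simp only [hD] at h
  linarith

/-- The representative of `z` in `H¹(0,1)` that is continuous on `[0,1]`; its values `H1.rep z 0` and
`H1.rep z 1` are the boundary values (traces) of `z`. -/
def H1.rep (z : H1) : ℝ → ℝ := (H1.exists_rep z).choose

theorem H1.rep_continuousOn (z : H1) : ContinuousOn (H1.rep z) (Icc 0 1) :=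
  (H1.exists_rep z).choose_spec.1

theorem H1.toH_ae_eq_rep (z : H1) : H1.toH z =ᵐ[vol 1] (H1.rep z) :=
  (H1.exists_rep z).choose_spec.2

theorem H1.rep_unique (z : H1) {f : ℝ → ℝ} (hf : ContinuousOn f (Icc 0 1))
    (h : H1.toH z =ᵐ[vol 1] f) : EqOn (H1.rep z) f (Icc 0 1) := by
  refine Measure.eqOn_Icc_of_ae_eq (μ := volume) zero_ne_one ?_ (H1.rep_continuousOn z) hf
  rw [← restrict_Ioo_eq_restrict_Icc]
  exact (H1.toH_ae_eq_rep z).symm.trans h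

/-- `X = {z ∈ H¹(0,1) : z(0) = 0}` with the norm of `H¹(0,1)`. -/
def X : Submodule ℝ H1 where
  carrier := {z | H1.rep z 0 = 0}
  zero_mem' := by
    have h : H1.toH 0 =ᵐ[vol 1] fun _ => (0 : ℝ) := by
      rw [map_zero]
      exact Lp.coeFn_zero _ _ _
    exact H1.rep_unique 0 continuousOn_const h (left_mem_Icc.2 zero_le_one)
  add_mem' := by
    intro a b ha hb
    have h : H1.toH (a + b) =ᵐ[vol 1] fun y => H1.rep a y + H1.rep b y := by
      rw [map_add]
      filter_upwards [Lp.coeFn_add (H1.toH a) (H1.toH b), (H1.toH_ae_eq_rep a), (H1.toH_ae_eq_rep b)]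
        with y h1 h2 h3
      rw [h1, Pi.add_apply, h2, h3]
    have h' := H1.rep_unique _ ((H1.rep_continuousOn a).add (H1.rep_continuousOn b)) h
      (left_mem_Icc.2 zero_le_one)
    have ha' : H1.rep a 0 = 0 := ha
    have hb' : H1.rep b 0 = 0 := hb
    simpa [ha', hb'] using h'
  smul_mem' := by
    intro c a ha
    have h : H1.toH (c • a) =ᵐ[vol 1] fun y => c * H1.rep a y := by
      rw [map_smul]
      filter_upwards [Lp.coeFn_smul c (H1.toH a), (H1.toH_ae_eq_rep a)] with y h1 h2
      rw [h1, Pi.smul_apply, h2, smul_eq_mul]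
    have h' := H1.rep_unique _ (continuousOn_const.mul (H1.rep_continuousOn a)) h
      (left_mem_Icc.2 zero_le_one)
    have ha' : H1.rep a 0 = 0 := ha
    simpa [ha'] using h'

/-- The dual space of `X`, with the operator norm. -/
abbrev Xdual : Type := StrongDual ℝ X

/-- The embedding of `X` into `H`. -/
def X.toH : X →L[ℝ] H := H1.toH.comp X.subtypeL

/-- The canonical map of `H` into the dual space of `X`, `⟨toXdual h, z⟩ = (h, z)_H`. -/
def toXdual (h : H) : Xdual := (innerSL ℝ h).comp X.toH

/-! ### The free boundary problem -/

/-- The data of the problem `P(s₀, u₀, v₀, g, h)` together with its coefficients: the diffusion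
constants `κ₁` and `κ₂`, the constants `β` and `γ` of Henry's law, and the constants `α` and `p` of
the carbonation rate. -/
structure Problem where
  κ₁ : ℝ
  κ₂ : ℝ
  α : ℝ
  β : ℝ
  γ : ℝ
  p : ℝ
  s₀ : ℝ
  u₀ : ℝ → ℝ
  v₀ : ℝ → ℝ
  g : ℝ → ℝ
  h : ℝ → ℝ

/-- Henry's law `f(u,v) = β (γ v - u)`. -/
def Problem.f (P : Problem) (a b : ℝ) : ℝ := P.β * (P.γ * b - a)

/-- The reaction rate `ψ(r) = α |[r]⁺|^p`. -/
def Problem.ψ (P : Problem) (r : ℝ) : ℝ := P.α * (max r 0) ^ P.p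

/-- The function `ū(t,y) = u(t, s(t) y)` on the fixed domain. For `0 < y < 1` it involves the values
of `u` on `{(t,x) : 0 < x < s(t)}` only. -/
def bar (s : ℝ → ℝ) (u : ℝ → ℝ → ℝ) (t y : ℝ) : ℝ := u t (s t * y)

/-- `W` belongs to `W^{1,2}(0,T;X*)`, has the initial value `W(0) = W₀` and the derivative `W'`:
`W'` is in `L²(0,T;X*)`, and `W(t) = W₀ + ∫₀ᵗ W'` for almost every `t`. In other words, `W` agrees
almost everywhere with an absolutely continuous function that takes the value `W₀` at `0` and has
the derivative `W'` in `L²(0,T;X*)`. -/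
def IsW12 (T : ℝ) (W : ℝ → Xdual) (W₀ : Xdual) (W' : ℝ → Xdual) : Prop :=
  MemLp W' 2 (vol T) ∧ ∀ᵐ t ∂(vol T), W t = W₀ + ∫ τ in (0 : ℝ)..t, W' τ

/-- The part of the conditions on a weak solution that says that one component `w` lies in the right
spaces, has the boundary value `b` at `x = 0` and has the initial value `w₀`:
`w̄ ∈ W^{1,2}(0,T;X*) ∩ L^∞(0,T;H) ∩ L²(0,T;H¹(0,1)) ∩ L^∞(Q(T))`, `w̄ - b ∈ L²(0,T;X)` and
`w̄(0,y) = w₀(s₀ y)`. Here `W` is `w̄` as a function with values in `H¹(0,1)`, and `W'` is its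
time derivative with values in `X*`. -/
structure IsComponent (s₀ T : ℝ) (s : ℝ → ℝ) (w : ℝ → ℝ → ℝ) (b w₀ : ℝ → ℝ)
    (W : ℝ → H1) (W' : ℝ → Xdual) : Prop where
  repr : ∀ᵐ t ∂(vol T), H1.toH (W t) =ᵐ[vol 1] bar s w t
  memLp_H1 : MemLp W 2 (vol T)
  memLp_H : MemLp (fun t => H1.toH (W t)) ⊤ (vol T)
  bounded : MemLp (fun q : ℝ × ℝ => bar s w q.1 q.2) ⊤
    ((volume : Measure (ℝ × ℝ)).restrict (Ioo 0 T ×ˢ Ioo 0 1))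
  time_deriv : ∃ a : H, a =ᵐ[vol 1] (fun y => w₀ (s₀ * y)) ∧
    IsW12 T (fun t => toXdual (H1.toH (W t))) (toXdual a) W'
  boundary : ∃ Z : ℝ → X, MemLp Z 2 (vol T) ∧
    ∀ᵐ t ∂(vol T), X.toH (Z t) =ᵐ[vol 1] fun y => bar s w t y - b t

/-- The weak form of one of the two equations on the fixed domain. With `w̄ = W`, for all test
functions `z` in `V₀(T) = L^∞(0,T;H) ∩ L²(0,T;X)`,
`∫ ⟨w̄_t, z⟩ + ∫∫ κ/s² w̄_y z_y + ∫ s'/s q z(·,1) = ∫∫ (F + s'/s y w̄_y) z`. -/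
def WeakForm (κ T : ℝ) (s : ℝ → ℝ) (W : ℝ → H1) (W' : ℝ → Xdual) (q : ℝ → ℝ)
    (F : ℝ → ℝ → ℝ) : Prop :=
  ∀ Z : ℝ → X, MemLp Z 2 (vol T) → MemLp (fun t => X.toH (Z t)) ⊤ (vol T) →
    (∫ t in Ioo 0 T, W' t (Z t))
      + (∫ t in Ioo 0 T, ∫ y in Ioo (0 : ℝ) 1,
          κ / s t ^ 2 * H1.dy (W t) y * H1.dy (Z t : H1) y)
      + (∫ t in Ioo 0 T, deriv s t / s t * q t * H1.rep (Z t) 1)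
    = ∫ t in Ioo 0 T, ∫ y in Ioo (0 : ℝ) 1,
        (F t y + deriv s t / s t * y * H1.dy (W t) y) * X.toH (Z t) y

/-- `{s, u, v}` is a weak solution of the problem on `[0,T]`. A function `s` on `[0,T]` is in
`W^{1,∞}(0,T)` exactly if it is Lipschitz continuous, and `u(t,s(t))` is the boundary value of
`ū(t,·)` at `y = 1`. -/
def Problem.IsWeakSolutionOn (P : Problem) (T : ℝ) (s : ℝ → ℝ) (u v : ℝ → ℝ → ℝ) : Prop :=
  ∃ (U V : ℝ → H1) (U' V' : ℝ → Xdual),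
    (∃ K, LipschitzOnWith K s (Icc 0 T)) ∧ (∀ t ∈ Icc 0 T, 0 < s t) ∧
    IsComponent P.s₀ T s u P.g P.u₀ U U' ∧
    IsComponent P.s₀ T s v P.h P.v₀ V V' ∧
    (∀ᵐ t ∂(vol T), deriv s t = P.ψ (H1.rep (U t) 1)) ∧ s 0 = P.s₀ ∧
    WeakForm P.κ₁ T s U U' (fun t => H1.rep (U t) 1 + 1)
      (fun t y => P.f (bar s u t y) (bar s v t y)) ∧
    WeakForm P.κ₂ T s V V' (fun t => H1.rep (V t) 1)
      (fun t y => -P.f (bar s u t y) (bar s v t y))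

/-- `{s, u, v}` is a weak solution of the problem on `[0,∞)`. -/
def Problem.IsWeakSolution (P : Problem) (s : ℝ → ℝ) (u v : ℝ → ℝ → ℝ) : Prop :=
  ∀ T > 0, P.IsWeakSolutionOn T s u v

/-- `w₀` is a nonnegative element of `L^∞(0,s₀)`. -/
def IsInitialDatum (s₀ : ℝ) (w₀ : ℝ → ℝ) : Prop :=
  MemLp w₀ ⊤ (vol s₀) ∧ ∀ᵐ x ∂(vol s₀), 0 ≤ w₀ x

end

end Carbonation

/-!
The proof is an energy estimate for the deviations `z = ū - g_*` and `ζ = v̄ - h_*` from the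
boundary values. Since `γ h_* = g_*`, Henry's law reads `f = β (γ ζ - z)`. Written on the moving
domain, testing the first equation with `u - g_*` and `γ` times the second with `v - h_*` makes the
reaction contribute `-β ∫ (γ (v - h_*) - (u - g_*))² ≤ 0`. With `a(t) = u(t, s(t)) - g_*`, the
boundary term of the first equation is `s' (a²/2 + (g_* + 1) a)`. It is bounded below by
`-s' (g_*²/2 + g_*)`, because `s' = ψ(a + g_*)` vanishes where `a + g_* ≤ 0`. The boundary term of
the second is at least `-s' h_*²/2`. Hence the dissipation up to time `T` is at most
`E + C (s(T) - s₀)`, where `E` and `C` depend on the data only. As `a² ≤ ∫ z_y²` on `(0,1)`,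
this gives `(κ₁/s(T)) ∫₀ᵀ a² ≤ E + C (s(T) - s₀)` (`Problem.IsWeakSolutionOn.exists_trace`).

On the other hand `a` and `ψ(a + g_*)` cannot both be small: pointwise
`g_*/4 ≤ L ψ(a + g_*) + a²/g_*` (`Problem.quarter_le`). Integrating and using `ψ(a + g_*) = s'`, one
finds `T ≤ M s(T)²`.

On the fixed domain the test function that corresponds to `u - g_*` is `s z`. The delicate point is
the time derivative, which is only an element of `L²(0,T;X*)`. The one-sided estimate
`∫ ⟨ū_t, s z⟩ ≥ -s₀ ‖z(0)‖²/2 - ∫ s' ‖z‖²/2` suffices (`integral_weighted_pairing_ge`). For backward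
difference quotients it is the polarization inequality `(a - b, a) ≥ (‖a‖² - ‖b‖²)/2` followed by
a summation by parts, and the limit is taken by means of the continuity of translations in `L²`.
-/

namespace Carbonation

open scoped Topology InnerProductSpace

/-! ### Averages over short time intervals -/

theorem continuous_integral_pairing_translate {E F : Type*} [NormedAddCommGroup E]
    [NormedSpace ℝ E] [NormedAddCommGroup F] [NormedSpace ℝ F] (B : E →L[ℝ] F →L[ℝ] ℝ)
    {f : ℝ → E} {g : ℝ → F} (hf : MemLp f 2 volume) (hg : MemLp g 2 volume) :
    Continuous fun r => ∫ t, B (f (t - r)) (g t) := by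
  have hmp : ∀ r : ℝ, MeasurePreserving (fun t : ℝ => t - r) volume volume := fun r =>
    measurePreserving_sub_right volume r
  let σ : C(ℝ, C(ℝ, ℝ)) := ContinuousMap.curry ⟨fun p : ℝ × ℝ => p.2 - p.1, by fun_prop⟩
  have h1 : Continuous fun r => Lp.compMeasurePreserving (σ r) (hmp r) (hf.toLp f) :=
    continuous_const.compMeasurePreservingLp σ.continuous hmp (by simp)
  have h2 : Continuous fun r => B.lpPairing volume 2 2
      (Lp.compMeasurePreserving (σ r) (hmp r) (hf.toLp f)) (hg.toLp g) :=
    ((B.lpPairing volume 2 2).flip (hg.toLp g)).continuous.comp h1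
  convert h2 using 2 with r
  rw [ContinuousLinearMap.lpPairing_eq_integral]
  refine integral_congr_ae ?_
  have h3 := Lp.coeFn_compMeasurePreserving (hf.toLp f) (hmp r)
  have h4 := (hmp r).quasiMeasurePreserving.ae_eq_comp hf.coeFn_toLp
  filter_upwards [h3, h4, hg.coeFn_toLp] with t a b c
  rw [c]
  erw [a]
  erw [b]
  rfl

/-- Averages over short time intervals converge weakly in `L²`: after exchanging the integrals, the
left-hand side is the mean over `(0,h)` of the continuous function `r ↦ ∫ B (f (t - r)) (g t)`. -/
theorem tendsto_integral_pairing_average {E F : Type*} [NormedAddCommGroup E]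
    [NormedSpace ℝ E] [CompleteSpace E] [NormedAddCommGroup F] [NormedSpace ℝ F]
    (B : E →L[ℝ] F →L[ℝ] ℝ) {f : ℝ → E} {g : ℝ → F}
    (hf : MemLp f 2 volume) (hf1 : Integrable f) (hg : MemLp g 2 volume) (hg1 : Integrable g) :
    Tendsto (fun h : ℝ => h⁻¹ * ∫ t, B (∫ τ in (t - h)..t, f τ) (g t)) (𝓝[>] 0)
      (𝓝 (∫ t, B (f t) (g t))) := by
  set Φ : ℝ → ℝ := fun r => ∫ t, B (f (t - r)) (g t) with hΦ
  have hΦc : Continuous Φ := continuous_integral_pairing_translate B hf hg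
  have hd : HasDerivAt (fun h => ∫ r in (0 : ℝ)..h, Φ r) (Φ 0) 0 :=
    intervalIntegral.integral_hasDerivAt_right (hΦc.intervalIntegrable _ _)
      (hΦc.stronglyMeasurableAtFilter _ _) hΦc.continuousAt
  have hlim := hasDerivWithinAt_iff_tendsto_slope.1 (hd.hasDerivWithinAt (s := Ioi 0))
  have h0 : Φ 0 = ∫ t, B (f t) (g t) := by simp [hΦ]
  rw [← h0]
  have hs : Ioi (0 : ℝ) \ {0} = Ioi 0 := by simp
  rw [hs] at hlim
  refine hlim.congr' ?_
  filter_upwards [self_mem_nhdsWithin] with h hh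
  have hh0 : (0 : ℝ) < h := hh
  rw [slope_def_field]
  simp only [intervalIntegral.integral_same, sub_zero]
  rw [div_eq_inv_mul]
  congr 1
  have hint : Integrable (fun p : ℝ × ℝ => B (f (p.2 - p.1)) (g p.2))
      ((volume : Measure ℝ).prod volume) := by
    have h := Integrable.convolution_integrand (μ := volume) (ν := volume) B.flip hg1
      hf1.comp_neg
    simpa using h
  have hint' : Integrable (fun p : ℝ × ℝ => B (f (p.2 - p.1)) (g p.2))
      ((volume.restrict (Ioc 0 h)).prod volume) := by
    refine hint.mono_measure ?_
    exact Measure.prod_mono Measure.restrict_le_self le_rfl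
  rw [intervalIntegral.integral_of_le hh0.le, hΦ]
  rw [integral_integral_swap hint']
  refine integral_congr_ae (Eventually.of_forall fun t => ?_)
  have e1 : ∫ τ in (t - h)..t, f τ = ∫ r in Ioc 0 h, f (t - r) := by
    rw [← intervalIntegral.integral_of_le hh0.le, intervalIntegral.integral_comp_sub_left]
    simp
  have hi : Integrable (fun r => f (t - r)) (volume.restrict (Ioc 0 h)) :=
    (hf1.comp_sub_left t).integrableOn
  simp only
  rw [e1]
  exact ContinuousLinearMap.integral_comp_comm (B.flip (g t)) hi

/-! ### The pairing of a time derivative with the function itself -/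

/-- Summation by parts: the translation is moved from `n` to the weight `s`. The interval `(-h,0)`,
where `n` has the constant value `c`, contributes the first term on the right. -/
theorem integral_weight_mul_translate_le {s n : ℝ → ℝ} {T h c : ℝ} (hsc : Continuous s)
    (hsm : Monotone s) (hs0 : 0 ≤ s 0) (hn0 : ∀ t, 0 ≤ n t) (hnc : ∀ t ≤ 0, n t = c)
    (hni : ∀ a b, IntervalIntegrable n volume a b) (hh : 0 < h) (hhT : h < T) :
    ∫ t in Ioo 0 T, s t * n (t - h)
      ≤ h * (s h * c) + ∫ t in Ioo 0 T, s (t + h) * n t := by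
  have hFi : ∀ a b : ℝ, IntervalIntegrable (fun t => s (t + h) * n t) volume a b := fun a b =>
    (hni a b).continuousOn_mul (by fun_prop)
  have hT : 0 ≤ T := (hh.trans hhT).le
  rw [← integral_Ioc_eq_integral_Ioo, ← integral_Ioc_eq_integral_Ioo,
    ← intervalIntegral.integral_of_le hT, ← intervalIntegral.integral_of_le hT]
  have e1 : ∫ t in (0 : ℝ)..T, s t * n (t - h) = ∫ t in (-h)..(T - h), s (t + h) * n t := by
    have := intervalIntegral.integral_comp_sub_right (a := 0) (b := T)
      (fun t => s (t + h) * n t) h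
    simpa using this
  rw [e1, ← intervalIntegral.integral_add_adjacent_intervals (hFi (-h) 0) (hFi 0 (T - h)),
    ← intervalIntegral.integral_add_adjacent_intervals (hFi 0 (T - h)) (hFi (T - h) T)]
  have hpos : ∀ t, 0 ≤ t → 0 ≤ s (t + h) * n t := fun t ht =>
    mul_nonneg (hs0.trans (hsm (by linarith))) (hn0 t)
  have e2 : 0 ≤ ∫ t in (T - h)..T, s (t + h) * n t :=
    intervalIntegral.integral_nonneg (by linarith) fun t ht => hpos t (by linarith [ht.1])
  have e3 : ∫ t in (-h)..0, s (t + h) * n t ≤ ∫ t in (-h)..0, s h * c := by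
    refine intervalIntegral.integral_mono_on (by linarith) (hFi _ _) (by simp) fun t ht => ?_
    rw [hnc t ht.2]
    exact mul_le_mul_of_nonneg_right (hsm (by linarith [ht.2])) (hnc 0 le_rfl ▸ hn0 0)
  rw [intervalIntegral.integral_const, smul_eq_mul] at e3
  linarith

theorem tendsto_integral_difference_quotient {s n : ℝ → ℝ} {T : ℝ} {K : NNReal}
    (hs : LipschitzWith K s) (hn : IntegrableOn n (Ioo 0 T)) :
    Tendsto (fun h : ℝ => ∫ t in Ioo 0 T, h⁻¹ * (s (t + h) - s t) * n t) (𝓝[>] 0)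
      (𝓝 (∫ t in Ioo 0 T, deriv s t * n t)) := by
  refine tendsto_integral_filter_of_dominated_convergence (fun t => K * ‖n t‖) ?_ ?_ ?_ ?_
  · refine Eventually.of_forall fun h => ?_
    have hc := hs.continuous
    exact (by fun_prop : Continuous fun t => h⁻¹ * (s (t + h) - s t)).aestronglyMeasurable.mul
      hn.aestronglyMeasurable
  · filter_upwards [self_mem_nhdsWithin] with h hh
    have hh0 : (0 : ℝ) < h := hh
    refine Eventually.of_forall fun t => ?_
    rw [norm_mul]
    refine mul_le_mul_of_nonneg_right ?_ (norm_nonneg _)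
    have h1 := hs.dist_le_mul (t + h) t
    rw [norm_mul, norm_inv, inv_mul_le_iff₀ (norm_pos_iff.2 hh0.ne')]
    simp only [dist_eq_norm, add_sub_cancel_left] at h1
    linarith
  · exact hn.norm.const_mul _
  · filter_upwards [ae_restrict_of_ae hs.ae_differentiableAt_real] with t ht
    refine Tendsto.mul_const _ ?_
    have := ht.hasDerivAt.tendsto_slope_zero_right
    simpa using this

/-- The polarization inequality `(b - a, b) ≥ (‖b‖² - ‖a‖²)/2` for two values `a`, `b` of a function
with the derivative `f` in the dual space. -/
theorem pairing_increment_ge {E G : Type*} [NormedAddCommGroup E] [NormedSpace ℝ E]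
    [NormedAddCommGroup G] [InnerProductSpace ℝ G] {ι : E →L[ℝ] G} {a b z₀ : G} {x : E}
    {f : ℝ → StrongDual ℝ E} {t₁ t₂ : ℝ} (hf : Integrable f)
    (ha : ⟪a, ι x⟫_ℝ = ⟪z₀, ι x⟫_ℝ + (∫ τ in (0 : ℝ)..t₁, f τ) x)
    (hb : ⟪b, ι x⟫_ℝ = ⟪z₀, ι x⟫_ℝ + (∫ τ in (0 : ℝ)..t₂, f τ) x) (hx : ι x = b) :
    (‖b‖ ^ 2 - ‖a‖ ^ 2) / 2 ≤ (∫ τ in t₁..t₂, f τ) x := by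
  have h5 : ∫ τ in t₁..t₂, f τ = (∫ τ in (0 : ℝ)..t₂, f τ) - ∫ τ in (0 : ℝ)..t₁, f τ :=
    (intervalIntegral.integral_interval_sub_left hf.intervalIntegrable
      hf.intervalIntegrable).symm
  have h6 : (∫ τ in t₁..t₂, f τ) x = ⟪b, b⟫_ℝ - ⟪a, b⟫_ℝ := by
    rw [h5, _root_.sub_apply, ← hx, ha, hx]
    rw [hx] at hb
    rw [hb]; ring
  have h7 := norm_sub_sq_real a b
  have h8 := sq_nonneg ‖a - b‖
  rw [h6, real_inner_self_eq_norm_sq]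
  linarith

/-- If the inequality `∫ ⟨w(t) - w(t-h), g⟩ ≥ ∫ s (n(t) - n(t-h))/2` holds for the increments of a
primitive `w` of `f`, then the corresponding inequality holds in the limit `h → 0`. -/
theorem weighted_pairing_ge_of_increments {E : Type*} [NormedAddCommGroup E] [NormedSpace ℝ E]
    {f : ℝ → StrongDual ℝ E} {g : ℝ → E} {n s : ℝ → ℝ} {T c : ℝ} {K : NNReal} (hT : 0 < T)
    (hf : MemLp f 2 volume) (hf1 : Integrable f) (hg : MemLp g 2 volume) (hg1 : Integrable g)
    (hn0 : ∀ t, 0 ≤ n t) (hnc : ∀ t ≤ 0, n t = c) (hni : ∀ a b, IntervalIntegrable n volume a b)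
    (hs : LipschitzWith K s) (hsm : Monotone s) (hs0 : 0 ≤ s 0)
    (hinc : ∀ h > 0, ∫ t in Ioo 0 T, s t * ((n t - n (t - h)) / 2)
      ≤ ∫ t, (∫ τ in (t - h)..t, f τ) (g t)) :
    -(s 0 * c) / 2 - (∫ t in Ioo 0 T, deriv s t * n t) / 2 ≤ ∫ t, f t (g t) := by
  have hsc : Continuous s := hs.continuous
  have hlim := tendsto_integral_pairing_average
    (ContinuousLinearMap.id ℝ (StrongDual ℝ E)) hf hf1 hg hg1
  simp only [ContinuousLinearMap.id_apply] at hlim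
  have hdq := tendsto_integral_difference_quotient hs
    ((hni 0 T).1.mono_set Ioo_subset_Ioc_self)
  have hsh : Tendsto (fun h => -(s h * c) / 2) (𝓝[>] 0) (𝓝 (-(s 0 * c) / 2)) :=
    ((by fun_prop : Continuous fun h => -(s h * c) / 2).tendsto 0).mono_left
      nhdsWithin_le_nhds
  refine le_of_tendsto_of_tendsto (hsh.sub (hdq.div_const 2)) hlim ?_
  filter_upwards [Ioo_mem_nhdsGT hT] with h hh
  have hi1 : ∀ r, IntegrableOn (fun t => s (t + r) * n t) (Ioo 0 T) := fun r =>
    ((hni 0 T).continuousOn_mul (f := n) (g := fun t => s (t + r))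
      (by fun_prop)).1.mono_set Ioo_subset_Ioc_self
  have hi0 : IntegrableOn (fun t => s t * n t) (Ioo 0 T) := by simpa using hi1 0
  have hi2 : IntegrableOn (fun t => s t * n (t - h)) (Ioo 0 T) := by
    have h1 : IntervalIntegrable (fun t => n (t - h)) volume 0 T := by
      simpa using (hni (-h) (T - h)).comp_sub_right h
    exact (h1.continuousOn_mul (f := fun t => n (t - h)) (g := s)
      hsc.continuousOn).1.mono_set Ioo_subset_Ioc_self
  have hsum := integral_weight_mul_translate_le hsc hsm hs0 hn0 hnc hni hh.1 hh.2
  have e1 : ∫ t in Ioo 0 T, s t * ((n t - n (t - h)) / 2)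
      = ((∫ t in Ioo 0 T, s t * n t) - ∫ t in Ioo 0 T, s t * n (t - h)) / 2 := by
    rw [← integral_sub hi0 hi2, ← integral_div]
    congr 1
    ext t
    ring
  have e2 : ∫ t in Ioo 0 T, h⁻¹ * (s (t + h) - s t) * n t
      = h⁻¹ * ((∫ t in Ioo 0 T, s (t + h) * n t) - ∫ t in Ioo 0 T, s t * n t) := by
    rw [← integral_sub (hi1 h) hi0, ← integral_const_mul]
    congr 1
    ext t
    ring
  have hlow := hinc h hh.1
  rw [e1] at hlow
  rw [e2]
  generalize (∫ t in Ioo 0 T, s (t + h) * n t) = A at *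
  generalize (∫ t in Ioo 0 T, s t * n t) = B at *
  generalize (∫ t, (∫ τ in (t - h)..t, f τ) (g t)) = D at *
  have hpos : (0 : ℝ) < h := hh.1
  have e3 : -(s h * c) / 2 - h⁻¹ * (A - B) / 2 = h⁻¹ * (-(h * (s h * c)) / 2 - (A - B) / 2) := by
    field_simp
  rw [e3]
  exact mul_le_mul_of_nonneg_left (by linarith) (by positivity)

/-- Extension by zero. It is stated for an arbitrary normed group, so that it applies to dual spaces
without unfolding their instances. -/
theorem exists_zero_extension {F : Type*} [NormedAddCommGroup F] {T : ℝ} {w : ℝ → F}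
    (hw : MemLp w 2 (vol T)) : ∃ f : ℝ → F, MemLp f 2 volume ∧ Integrable f ∧
      (∀ t ∈ Ioo 0 T, f t = w t) ∧ ∀ t ∉ Ioo 0 T, f t = 0 :=
  ⟨indicator (Ioo 0 T) w, (memLp_indicator_iff_restrict measurableSet_Ioo).2 hw,
    (integrable_indicator_iff measurableSet_Ioo).2 (hw.integrable one_le_two),
    fun _ ht => indicator_of_mem ht _, fun _ ht => indicator_of_notMem ht _⟩

/-- One half of the integration by parts in time in a Gelfand triple, with a monotone weight. If
`ι ∘ Z`, seen as a function with values in the dual space, has the derivative `W'` and the initial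
value `z₀`, then `∫ ⟨W', s Z⟩ ≥ -s(0) ‖z₀‖²/2 - ∫ s' ‖ι Z‖²/2`. -/
theorem integral_weighted_pairing_ge {E G : Type*} [NormedAddCommGroup E] [NormedSpace ℝ E]
    [NormedAddCommGroup G] [InnerProductSpace ℝ G] (ι : E →L[ℝ] G) {T : ℝ} (hT : 0 < T)
    {Z : ℝ → E} {W' : ℝ → StrongDual ℝ E} {z₀ : G} {s : ℝ → ℝ} {K : NNReal}
    (hZ : MemLp Z 2 (vol T)) (hW' : MemLp W' 2 (vol T))
    (hw : ∀ᵐ t ∂(vol T), ∀ x, ⟪ι (Z t), ι x⟫_ℝ = ⟪z₀, ι x⟫_ℝ + (∫ τ in (0 : ℝ)..t, W' τ) x)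
    (hs : LipschitzWith K s) (hsm : Monotone s) (hs0 : 0 ≤ s 0) :
    -(s 0 * ‖z₀‖ ^ 2) / 2 - (∫ t in Ioo 0 T, deriv s t * ‖ι (Z t)‖ ^ 2) / 2
      ≤ ∫ t in Ioo 0 T, W' t (s t • Z t) := by
  have hsc : Continuous s := hs.continuous
  -- The function is continued by its initial value to negative times, so that backward differences
  -- make sense on all of `(0,T)`.
  set ζ : ℝ → G := fun t => if t ≤ 0 then z₀ else (if t < T then ι (Z t) else 0) with hζ
  set n : ℝ → ℝ := fun t => ‖ζ t‖ ^ 2 with hn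
  have hζin : ∀ t ∈ Ioo 0 T, ζ t = ι (Z t) := fun t ht => by
    simp only [hζ, if_neg (not_le.2 ht.1), if_pos ht.2]
  have hsZ : MemLp (fun t => s t • Z t) 2 (vol T) := by
    obtain ⟨C, hC⟩ := isCompact_Icc.exists_bound_of_continuousOn (s := Icc 0 T) hsc.continuousOn
    refine hZ.of_le_mul (c := C) (hsc.aestronglyMeasurable.smul hZ.aestronglyMeasurable) ?_
    filter_upwards [ae_restrict_mem measurableSet_Ioo] with t ht
    rw [norm_smul]
    exact mul_le_mul_of_nonneg_right (hC t (Ioo_subset_Icc_self ht)) (norm_nonneg _)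
  obtain ⟨f, hfL, hf1, hfin, hfout⟩ := exists_zero_extension hW'
  obtain ⟨g, hgL, hg1, hgin, hgout⟩ := exists_zero_extension hsZ
  have hnT : IntegrableOn n (Ioo 0 T) := by
    have h1 : Integrable (fun t => ‖ι (Z t)‖ ^ 2) (vol T) :=
      (ι.comp_memLp' hZ).integrable_norm_pow (by norm_num)
    exact h1.congr ((ae_restrict_mem measurableSet_Ioo).mono fun t ht => by
      simp only [hn, hζin t ht])
  have hnl : ∀ a b, IntervalIntegrable n volume a b := by
    have e : n = fun t => indicator (Iic 0) (fun _ => ‖z₀‖ ^ 2) t + indicator (Ioo 0 T) n t := by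
      ext t
      rcases le_or_gt t 0 with h0 | h0
      · simp [hn, hζ, h0, not_lt.2 h0]
      · rcases lt_or_ge t T with h1 | h1
        · simp [h0, h1, not_le.2 h0]
        · simp [hn, hζ, not_lt.2 h1, not_le.2 h0]
    intro a b
    rw [e]
    refine IntervalIntegrable.add ?_
      ((integrable_indicator_iff measurableSet_Ioo).2 hnT).intervalIntegrable
    rw [intervalIntegrable_iff]
    exact (integrableOn_const (by simp)).indicator measurableSet_Iic
  have hfi : ∀ t ∈ Ioo 0 T, ∫ τ in (0 : ℝ)..t, f τ = ∫ τ in (0 : ℝ)..t, W' τ := by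
    intro t ht
    refine intervalIntegral.integral_congr_ae (Eventually.of_forall fun τ hτ => ?_)
    rw [uIoc_of_le ht.1.le] at hτ
    exact hfin τ ⟨hτ.1, hτ.2.trans_lt ht.2⟩
  have hf0 : ∀ t ≤ 0, ∫ τ in (0 : ℝ)..t, f τ = 0 := by
    intro t ht
    refine (intervalIntegral.integral_congr (g := fun _ => 0) fun τ hτ => ?_).trans (by simp)
    rw [uIcc_of_ge ht] at hτ
    exact hfout τ fun h => not_lt.2 hτ.2 h.1
  have hP : ∀ᵐ t, t < T → ∀ x, ⟪ζ t, ι x⟫_ℝ = ⟪z₀, ι x⟫_ℝ + (∫ τ in (0 : ℝ)..t, f τ) x := by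
    rw [ae_restrict_iff' measurableSet_Ioo] at hw
    filter_upwards [hw] with t ht htT x
    rcases le_or_gt t 0 with h0 | h0
    · simp [hf0 t h0, hζ, h0]
    · rw [hfi t ⟨h0, htT⟩, hζin t ⟨h0, htT⟩, ht ⟨h0, htT⟩]
  have hpair : ∀ F : ℝ → StrongDual ℝ E,
      ∫ t, F t (g t) = ∫ t in Ioo 0 T, F t (s t • Z t) := by
    intro F
    rw [← integral_indicator measurableSet_Ioo]
    congr 1
    ext t
    by_cases ht : t ∈ Ioo 0 T
    · rw [indicator_of_mem ht, hgin t ht]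
    · rw [indicator_of_notMem ht, hgout t ht, map_zero]
  have hmain := weighted_pairing_ge_of_increments hT hfL hf1 hgL hg1 (n := n) (c := ‖z₀‖ ^ 2)
    (fun t => sq_nonneg _) (fun t ht => by simp [hn, hζ, ht]) hnl hs hsm hs0 ?_
  · have hrhs : ∫ t in Ioo 0 T, deriv s t * ‖ι (Z t)‖ ^ 2 = ∫ t in Ioo 0 T, deriv s t * n t :=
      setIntegral_congr_fun measurableSet_Ioo fun t ht => by simp only [hn, hζin t ht]
    have hlhs : ∫ t in Ioo 0 T, W' t (s t • Z t) = ∫ t, f t (g t) := by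
      rw [hpair]
      exact setIntegral_congr_fun measurableSet_Ioo fun t ht => by rw [hfin t ht]
    rw [hrhs, hlhs]
    exact hmain
  intro h hh
  rw [hpair]
  have hi0 : ∀ r, IntegrableOn (fun t => s t * n (t - r)) (Ioo 0 T) := fun r => by
    have h1 : IntervalIntegrable (fun t => n (t - r)) volume 0 T := by
      simpa using (hnl (0 - r) (T - r)).comp_sub_right r
    exact (h1.continuousOn_mul (f := fun t => n (t - r)) (g := s)
      hsc.continuousOn).1.mono_set Ioo_subset_Ioc_self
  refine integral_mono_ae ?_ ?_ ?_
  · refine (((hi0 0).sub (hi0 h)).div_const 2).congr (Eventually.of_forall fun t => ?_)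
    simp only [Pi.sub_apply, sub_zero]; ring
  · have hprim : Continuous fun t => ∫ τ in (t - h)..t, f τ := by
      have h1 := intervalIntegral.continuous_primitive (fun a b => hf1.intervalIntegrable) 0
      have h2 : (fun t => ∫ τ in (t - h)..t, f τ)
          = fun t => (∫ τ in (0 : ℝ)..t, f τ) - ∫ τ in (0 : ℝ)..(t - h), f τ := by
        ext1 t
        exact (intervalIntegral.integral_interval_sub_left hf1.intervalIntegrable
          hf1.intervalIntegrable).symm
      rw [h2]
      exact h1.sub (h1.comp (continuous_sub_right h))
    obtain ⟨C, hC⟩ := isCompact_Icc.exists_bound_of_continuousOn (s := Icc 0 T) hprim.continuousOn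
    refine ((hsZ.integrable (by norm_num)).norm.const_mul C).mono' ?_ ?_
    · exact (ContinuousLinearMap.id ℝ (StrongDual ℝ E)).aestronglyMeasurable_comp₂
        hprim.aestronglyMeasurable hsZ.aestronglyMeasurable
    · filter_upwards [ae_restrict_mem measurableSet_Ioo] with t ht
      exact (ContinuousLinearMap.le_opNorm _ _).trans
        (mul_le_mul_of_nonneg_right (hC t (Ioo_subset_Icc_self ht)) (norm_nonneg _))
  · have hP' := (measurePreserving_sub_right (volume : Measure ℝ) h).quasiMeasurePreserving.ae hP
    filter_upwards [ae_restrict_of_ae hP, ae_restrict_of_ae hP', ae_restrict_mem measurableSet_Ioo]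
      with t h1 h2 ht
    rw [map_smul, smul_eq_mul]
    exact mul_le_mul_of_nonneg_left
      (pairing_increment_ge hf1 (h2 (by linarith [ht.2]) (Z t)) (h1 ht.2 (Z t)) (hζin t ht).symm)
      (hs0.trans (hsm ht.1.le))

/-! ### Boundary values and integration by parts in `H¹(0,1)` -/

theorem IsTest.sub_const_mul {φ r : ℝ → ℝ} (hφ : IsTest φ) (hr : IsTest r) (m : ℝ) :
    IsTest fun y => φ y - m * r y := by
  have hs : tsupport (fun y => φ y - m * r y) ⊆ tsupport φ ∪ tsupport r := by
    refine closure_minimal (fun y hy => ?_) ((isClosed_tsupport _).union (isClosed_tsupport _))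
    by_contra hn
    rw [mem_union, not_or] at hn
    exact hy (by simp [image_eq_zero_of_notMem_tsupport hn.1,
      image_eq_zero_of_notMem_tsupport hn.2])
  exact ⟨hφ.1.sub (contDiff_const.mul hr.1),
    (IsCompact.union hφ.2.1 hr.2.1).of_isClosed_subset (isClosed_tsupport _) hs,
    hs.trans (union_subset hφ.2.2 hr.2.2)⟩

theorem exists_test_integral_eq_one : ∃ r, IsTest r ∧ ∫ y, r y = 1 := by
  let ρ : ContDiffBump (1 / 2 : ℝ) := ⟨1 / 8, 1 / 4, by norm_num, by norm_num⟩
  refine ⟨ρ.normed volume, ⟨ρ.contDiff_normed, ρ.hasCompactSupport_normed, ?_⟩,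
    ρ.integral_normed⟩
  rw [ρ.tsupport_normed_eq, Real.closedBall_eq_Icc]
  exact Icc_subset_Ioo (by norm_num [ρ]) (by norm_num [ρ])

theorem IsTest.setIntegral_eq {φ : ℝ → ℝ} (hφ : IsTest φ) :
    ∫ y in Ioo (0 : ℝ) 1, φ y = ∫ y, φ y :=
  setIntegral_eq_integral_of_forall_compl_eq_zero fun _ hx =>
    image_eq_zero_of_notMem_tsupport fun h => hx (hφ.2.2 h)

/-- The lemma of du Bois-Reymond: an integrable function with weak derivative zero is constant. -/
theorem exists_ae_eq_const_of_integral_deriv_eq_zero {D : ℝ → ℝ} (hD : Integrable D (vol 1))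
    (h0 : ∀ φ, IsTest φ → ∫ y in Ioo (0 : ℝ) 1, D y * deriv φ y = 0) :
    ∃ c : ℝ, ∀ᵐ y ∂(vol 1), D y = c := by
  have hmul : ∀ φ, IsTest φ → Integrable (fun y => D y * φ y) (vol 1) := by
    intro φ hφ
    obtain ⟨C, hC⟩ := hφ.2.1.exists_bound_of_continuous hφ.1.continuous
    exact hD.mul_bdd hφ.1.continuous.aestronglyMeasurable (Eventually.of_forall hC)
  have hint : ∀ φ, IsTest φ → Integrable φ := fun φ hφ =>
    hφ.1.continuous.integrable_of_hasCompactSupport hφ.2.1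
  obtain ⟨r, hr, hr1⟩ := exists_test_integral_eq_one
  refine ⟨∫ y in Ioo (0 : ℝ) 1, D y * r y, ?_⟩
  set c : ℝ := ∫ y in Ioo (0 : ℝ) 1, D y * r y
  have hfin : ∀ φ, IsTest φ → ∫ y in Ioo (0 : ℝ) 1, (D y - c) * φ y = 0 := by
    intro φ hφ
    set m : ℝ := ∫ y, φ y with hm
    have hχ := hφ.sub_const_mul hr m
    have hχ0 : ∫ y, (φ y - m * r y) = 0 := by
      rw [integral_sub (hint φ hφ) ((hint r hr).const_mul m), integral_const_mul, hr1]
      simp [hm]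
    obtain ⟨η, hη, hηd⟩ := exists_test_primitive hχ hχ0
    have h := h0 η hη
    rw [hηd] at h
    have e1 : ∫ y in Ioo (0 : ℝ) 1, D y * (φ y - m * r y)
        = (∫ y in Ioo (0 : ℝ) 1, D y * φ y) - m * c := by
      rw [← integral_const_mul, ← integral_sub (hmul φ hφ) ((hmul r hr).const_mul m)]
      exact integral_congr_ae (Eventually.of_forall fun y => by ring)
    have e2 : ∫ y in Ioo (0 : ℝ) 1, (D y - c) * φ y
        = (∫ y in Ioo (0 : ℝ) 1, D y * φ y) - c * m := by
      rw [hm, ← hφ.setIntegral_eq, ← integral_const_mul,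
        ← integral_sub (hmul φ hφ) ((hint φ hφ).restrict.const_mul c)]
      exact integral_congr_ae (Eventually.of_forall fun y => by ring)
    linarith
  have hae : ∀ᵐ x, x ∈ Ioo (0 : ℝ) 1 → D x - c = 0 := by
    refine isOpen_Ioo.ae_eq_zero_of_integral_contDiff_smul_eq_zero ?_ ?_
    · have hDc : IntegrableOn (fun x => D x - c) (Ioo (0 : ℝ) 1) := hD.sub (integrable_const c)
      exact hDc.locallyIntegrableOn
    · intro g hg hgc hgs
      rw [← hfin g ⟨hg, hgc, hgs⟩, ← setIntegral_eq_integral_of_forall_compl_eq_zero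
        (s := Ioo (0 : ℝ) 1)]
      · exact integral_congr_ae (Eventually.of_forall fun y => by simp [mul_comm])
      · intro x hx
        rw [image_eq_zero_of_notMem_tsupport fun h => hx (hgs h), zero_smul]
  rw [ae_restrict_iff' measurableSet_Ioo]
  filter_upwards [hae] with x hx hx'
  exact sub_eq_zero.1 (hx hx')

theorem intervalIntegrable_H (w : H) : IntervalIntegrable w volume 0 1 := by
  rw [intervalIntegrable_iff_integrableOn_Ioo_of_le zero_le_one]
  exact integrable_H _

theorem absolutelyContinuous_primitive (w : H) :
    AbsolutelyContinuousOnInterval (fun y => ∫ x in (0 : ℝ)..y, w x) 0 1 :=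
  (intervalIntegrable_H w).absolutelyContinuousOnInterval_intervalIntegral (c := 0) (by simp)

theorem continuousOn_primitive (w : H) :
    ContinuousOn (fun y => ∫ x in (0 : ℝ)..y, w x) (Icc 0 1) := by
  simpa using (absolutelyContinuous_primitive w).continuousOn

theorem ae_hasDerivAt_primitive (w : H) :
    ∀ᵐ x, x ∈ Icc (0 : ℝ) 1 → HasDerivAt (fun y => ∫ x in (0 : ℝ)..y, w x) (w x) x := by
  filter_upwards [(intervalIntegrable_H w).ae_hasDerivAt_integral] with x hx hx'
  exact hx (by simpa using hx') 0 (by simp)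

/-- The fundamental theorem of calculus in `H¹(0,1)`. -/
theorem H1.rep_eq_add_integral (z : H1) :
    ∀ y ∈ Icc (0 : ℝ) 1, H1.rep z y = H1.rep z 0 + ∫ x in (0 : ℝ)..y, H1.dy z x := by
  set W : ℝ → ℝ := fun y => ∫ x in (0 : ℝ)..y, H1.dy z x with hW
  have hWc : ContinuousOn W (Icc 0 1) := continuousOn_primitive _
  have hWI : Integrable W (vol 1) := hWc.integrableOn_Icc.mono_set Ioo_subset_Icc_self
  have hparts : ∀ φ, IsTest φ →
      ∫ y in Ioo (0 : ℝ) 1, W y * deriv φ y = -∫ y in Ioo (0 : ℝ) 1, H1.dy z y * φ y := by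
    intro φ hφ
    have hφAC : AbsolutelyContinuousOnInterval φ 0 1 :=
      ((hφ.1.of_le (by simp)).contDiffOn).absolutelyContinuousOnInterval
    have h := (absolutelyContinuous_primitive (H1.dy z)).integral_mul_deriv_eq_deriv_mul hφAC
    have hφ0 : φ 0 = 0 := image_eq_zero_of_notMem_tsupport fun h => by simpa using hφ.2.2 h
    have hφ1 : φ 1 = 0 := image_eq_zero_of_notMem_tsupport fun h => by simpa using hφ.2.2 h
    rw [hφ0, hφ1, mul_zero, mul_zero, sub_zero, zero_sub] at h
    have h2 : ∫ x in (0 : ℝ)..1, deriv W x * φ x = ∫ x in (0 : ℝ)..1, H1.dy z x * φ x := by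
      refine intervalIntegral.integral_congr_ae ?_
      filter_upwards [ae_hasDerivAt_primitive (H1.dy z)] with x hx hx'
      rw [uIoc_of_le zero_le_one] at hx'
      rw [(hx (Ioc_subset_Icc_self hx')).deriv]
    rw [h2] at h
    simpa only [intervalIntegral.integral_of_le zero_le_one, integral_Ioc_eq_integral_Ioo] using h
  obtain ⟨c, hc⟩ := exists_ae_eq_const_of_integral_deriv_eq_zero
    (D := fun y => H1.toH z y - W y) ((integrable_H _).sub hWI) (by
      intro φ hφ
      have hWm : Integrable (fun y => W y * deriv φ y) (vol 1) := by
        obtain ⟨C, hC⟩ := hφ.2.1.deriv.exists_bound_of_continuous hφ.deriv_continuous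
        exact hWI.mul_bdd hφ.deriv_continuous.aestronglyMeasurable (Eventually.of_forall hC)
      simp only [sub_mul]
      rw [integral_sub (integrable_mul _ hφ.deriv_continuous hφ.2.1.deriv) hWm, hparts φ hφ,
        H1.isWeakDeriv z φ hφ, sub_self])
  have hrep : EqOn (H1.rep z) (fun y => c + W y) (Icc 0 1) := by
    refine H1.rep_unique z (continuousOn_const.add hWc) ?_
    filter_upwards [hc] with y hy
    linarith
  intro y hy
  rw [hrep hy, hrep (left_mem_Icc.2 zero_le_one)]
  simp [hW]

theorem H1.rep_eq_of_ae_add_const {z w : H1} {b : ℝ}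
    (h : H1.toH w =ᵐ[vol 1] fun y => H1.toH z y + b) :
    ∀ y ∈ Icc (0 : ℝ) 1, H1.rep w y = H1.rep z y + b := by
  refine H1.rep_unique w ((H1.rep_continuousOn z).add continuousOn_const) ?_
  filter_upwards [h, H1.toH_ae_eq_rep z] with y h1 h2
  rw [h1, h2]

theorem H1.dy_eq_of_ae_add_const {z w : H1} {b : ℝ}
    (h : H1.toH w =ᵐ[vol 1] fun y => H1.toH z y + b) : H1.dy w = H1.dy z := by
  have hrep := H1.rep_eq_of_ae_add_const h
  have hprim : ∀ y ∈ Icc (0 : ℝ) 1,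
      ∫ x in (0 : ℝ)..y, H1.dy w x = ∫ x in (0 : ℝ)..y, H1.dy z x := by
    intro y hy
    have h1 := H1.rep_eq_add_integral w y hy
    have h2 := H1.rep_eq_add_integral z y hy
    have h3 := hrep y hy
    have h4 := hrep 0 (left_mem_Icc.2 zero_le_one)
    linarith
  refine Lp.ext ?_
  rw [EventuallyEq, ae_restrict_iff' measurableSet_Ioo]
  filter_upwards [ae_hasDerivAt_primitive (H1.dy w), ae_hasDerivAt_primitive (H1.dy z)]
    with x h1 h2 hx
  have hx' := Ioo_subset_Icc_self hx
  refine (h1 hx').unique ((h2 hx').congr_of_eventuallyEq ?_)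
  filter_upwards [isOpen_Ioo.mem_nhds hx] with y hy
  exact hprim y (Ioo_subset_Icc_self hy)

theorem inner_H (a b : H) : ⟪a, b⟫_ℝ = ∫ y in Ioo (0 : ℝ) 1, a y * b y := by
  rw [L2.inner_def]
  exact integral_congr_ae (Eventually.of_forall fun y => by simp [mul_comm])

theorem norm_sq_H (a : H) : ‖a‖ ^ 2 = ∫ y in Ioo (0 : ℝ) 1, a y * a y := by
  rw [← real_inner_self_eq_norm_sq, inner_H]

theorem integrable_mul_H (a b : H) : Integrable (fun y => a y * b y) (vol 1) :=
  (Lp.memLp a).integrable_mul (Lp.memLp b)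

theorem X.rep_zero (z : X) : H1.rep z 0 = 0 := z.2

/-- The constant function `1` in `L²(0,1)`. -/
noncomputable def oneH : H := Lp.const 2 (vol 1) 1

theorem oneH_ae_eq : ∀ᵐ y ∂(vol 1), oneH y = 1 := Lp.coeFn_const 2 (vol 1) (1 : ℝ)

theorem norm_oneH : ‖oneH‖ = 1 := by
  have h : ‖oneH‖ ^ 2 = 1 := by
    rw [norm_sq_H, integral_congr_ae (g := fun _ => (1 : ℝ))
      (oneH_ae_eq.mono fun y hy => by simp only [hy, mul_one])]
    simp
  nlinarith [norm_nonneg oneH]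

theorem X.trace_eq_inner (z : X) : H1.rep z 1 = ⟪oneH, H1.dy z⟫_ℝ := by
  rw [H1.rep_eq_add_integral z 1 (right_mem_Icc.2 zero_le_one), X.rep_zero, zero_add, inner_H,
    intervalIntegral.integral_of_le zero_le_one, integral_Ioc_eq_integral_Ioo]
  refine integral_congr_ae ?_
  filter_upwards [oneH_ae_eq] with y hy
  rw [hy, one_mul]

theorem X.trace_sq_le (z : X) : H1.rep z 1 ^ 2 ≤ ‖H1.dy (z : H1)‖ ^ 2 := by
  rw [X.trace_eq_inner]
  have h := abs_real_inner_le_norm oneH (H1.dy (z : H1))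
  rw [norm_oneH, one_mul] at h
  exact sq_le_sq' (by linarith [neg_abs_le ⟪oneH, H1.dy (z : H1)⟫_ℝ]) ((le_abs_self _).trans h)

theorem X.trace_smul (c : ℝ) (z : X) : H1.rep (c • z : X) 1 = c * H1.rep z 1 := by
  rw [X.trace_eq_inner, X.trace_eq_inner, ← inner_smul_right]
  congr 1

/-- Integration by parts of `y (z²)_y / 2` over `(0,1)`. It turns the convection term of the
equation on the fixed domain into a boundary term. -/
theorem H1.integral_y_mul_dy_mul (z : H1) :
    ∫ y in Ioo (0 : ℝ) 1, y * H1.dy z y * H1.toH z y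
      = (H1.rep z 1 ^ 2 - ‖H1.toH z‖ ^ 2) / 2 := by
  set R : ℝ → ℝ := fun y => H1.rep z 0 + ∫ x in (0 : ℝ)..y, H1.dy z x with hR
  have hRrep : ∀ y ∈ Icc (0 : ℝ) 1, H1.rep z y = R y := H1.rep_eq_add_integral z
  have hRAC : AbsolutelyContinuousOnInterval R 0 1 :=
    ((contDiffOn_const (n := 1)).absolutelyContinuousOnInterval).add
      (absolutelyContinuous_primitive _)
  have hyAC : AbsolutelyContinuousOnInterval (fun y : ℝ => y) 0 1 :=
    (contDiff_id.contDiffOn).absolutelyContinuousOnInterval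
  have h := hyAC.integral_mul_deriv_eq_deriv_mul (hRAC.mul hRAC)
  have hz : ∀ᵐ y ∂(vol 1), H1.toH z y = R y := by
    filter_upwards [H1.toH_ae_eq_rep z, ae_restrict_mem measurableSet_Ioo] with y h1 h2
    rw [h1, hRrep y (Ioo_subset_Icc_self h2)]
  have e1 : ∫ y in (0 : ℝ)..1, y * deriv (R * R) y
      = 2 * ∫ y in Ioo (0 : ℝ) 1, y * H1.dy z y * H1.toH z y := by
    rw [intervalIntegral.integral_of_le zero_le_one, integral_Ioc_eq_integral_Ioo,
      ← integral_const_mul]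
    refine integral_congr_ae ?_
    filter_upwards [hz, ae_restrict_of_ae (ae_hasDerivAt_primitive (H1.dy z)),
      ae_restrict_mem measurableSet_Ioo] with y h1 h2 h3
    have h4 : HasDerivAt R (H1.dy z y) y := (h2 (Ioo_subset_Icc_self h3)).const_add _
    rw [(h4.mul h4).deriv, h1]
    ring
  have e2 : ∫ y in (0 : ℝ)..1, deriv (fun y : ℝ => y) y * (R * R) y = ‖H1.toH z‖ ^ 2 := by
    rw [intervalIntegral.integral_of_le zero_le_one, integral_Ioc_eq_integral_Ioo, norm_sq_H]
    refine integral_congr_ae ?_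
    filter_upwards [hz] with y h1
    simp [h1]
  rw [e1, e2] at h
  rw [hRrep 1 (right_mem_Icc.2 zero_le_one)]
  simp only [Pi.mul_apply] at h
  linarith

/-! ### Moving boundaries -/

theorem exists_lipschitz_extension {T : ℝ} (hT : 0 ≤ T) {s : ℝ → ℝ} {K : NNReal}
    (hs : LipschitzOnWith K s (Icc 0 T)) (hm : MonotoneOn s (Icc 0 T)) :
    ∃ r : ℝ → ℝ, LipschitzWith K r ∧ Monotone r ∧ (∀ t ∈ Icc 0 T, r t = s t) ∧
      ∀ t ∈ Ioo 0 T, deriv r t = deriv s t := by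
  have heq : ∀ t ∈ Icc 0 T, IccExtend hT (domRestrict (Icc 0 T) s) t = s t := fun t ht => by
    rw [IccExtend_of_mem _ _ ht]; rfl
  refine ⟨IccExtend hT (domRestrict (Icc 0 T) s), ?_, ?_, heq, ?_⟩
  · rw [← mul_one K]
    exact hs.to_restrict.comp (LipschitzWith.projIcc hT)
  · have h : Monotone (domRestrict (Icc 0 T) s) := fun x y hxy => hm x.2 y.2 hxy
    exact h.IccExtend hT
  · intro t ht
    refine EventuallyEq.deriv_eq ?_
    filter_upwards [isOpen_Ioo.mem_nhds ht] with y hy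
    exact heq y (Ioo_subset_Icc_self hy)

theorem memLp_inner {E : Type*} [NormedAddCommGroup E] [InnerProductSpace ℝ E] {T : ℝ}
    {f g : ℝ → E} (hf : MemLp f 2 (vol T)) (hg : MemLp g 2 (vol T)) :
    Integrable (fun t => ⟪f t, g t⟫_ℝ) (vol T) :=
  memLp_one_iff_integrable.1 (ContinuousLinearMap.memLp_of_bilin 1 (innerSL ℝ) hf hg)

theorem integrable_bdd_mul {T C : ℝ} {m f : ℝ → ℝ} (hf : Integrable f (vol T))
    (hm : AEStronglyMeasurable m (vol T)) (hC : ∀ t ∈ Ioo 0 T, ‖m t‖ ≤ C) :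
    Integrable (fun t => m t * f t) (vol T) :=
  hf.bdd_mul hm ((ae_restrict_mem measurableSet_Ioo).mono hC)

/-- `s` is a positive, nondecreasing and Lipschitz continuous function on `[0,T]`, as is the free
boundary of a weak solution. -/
structure IsFront (T : ℝ) (s : ℝ → ℝ) (K : NNReal) : Prop where
  lipschitz : LipschitzOnWith K s (Icc 0 T)
  monotone : MonotoneOn s (Icc 0 T)
  pos : 0 < s 0

namespace IsFront

variable {T : ℝ} {s : ℝ → ℝ} {K : NNReal}

theorem le_left (h : IsFront T s K) {t : ℝ} (ht : t ∈ Icc 0 T) : s 0 ≤ s t :=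
  h.monotone ⟨le_rfl, ht.1.trans ht.2⟩ ht ht.1

theorem le_right (h : IsFront T s K) {t : ℝ} (ht : t ∈ Icc 0 T) : s t ≤ s T :=
  h.monotone ht ⟨ht.1.trans ht.2, le_rfl⟩ ht.2

theorem pos' (h : IsFront T s K) {t : ℝ} (ht : t ∈ Icc 0 T) : 0 < s t :=
  h.pos.trans_le (h.le_left ht)

theorem measurable (h : IsFront T s K) : AEStronglyMeasurable s (vol T) :=
  (h.lipschitz.continuousOn.mono Ioo_subset_Icc_self).aestronglyMeasurable measurableSet_Ioo

theorem norm_le (h : IsFront T s K) : ∀ t ∈ Ioo 0 T, ‖s t‖ ≤ s T := fun t ht => by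
  rw [Real.norm_of_nonneg (h.pos' (Ioo_subset_Icc_self ht)).le]
  exact h.le_right (Ioo_subset_Icc_self ht)

theorem norm_deriv_le (h : IsFront T s K) : ∀ t ∈ Ioo 0 T, ‖deriv s t‖ ≤ K := fun _ ht =>
  norm_deriv_le_of_lipschitzOn (Icc_mem_nhds ht.1 ht.2) h.lipschitz

theorem integral_deriv (h : IsFront T s K) (hT : 0 ≤ T) :
    ∫ t in Ioo 0 T, deriv s t = s T - s 0 := by
  have hac : AbsolutelyContinuousOnInterval s 0 T := by
    refine LipschitzOnWith.absolutelyContinuousOnInterval (K := K) ?_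
    rw [uIcc_of_le hT]
    exact h.lipschitz
  rw [← integral_Ioc_eq_integral_Ioo, ← intervalIntegral.integral_of_le hT,
    hac.integral_deriv_eq_sub]

theorem integrable_deriv_mul (h : IsFront T s K) {f : ℝ → ℝ} (hf : Integrable f (vol T)) :
    Integrable (fun t => deriv s t * f t) (vol T) :=
  integrable_bdd_mul hf (measurable_deriv s).aestronglyMeasurable h.norm_deriv_le

theorem integrable_mul (h : IsFront T s K) {f : ℝ → ℝ} (hf : Integrable f (vol T)) :
    Integrable (fun t => s t * f t) (vol T) :=
  integrable_bdd_mul hf h.measurable h.norm_le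

theorem integrable_inv_mul (h : IsFront T s K) {f : ℝ → ℝ} (hf : Integrable f (vol T)) :
    Integrable (fun t => (s t)⁻¹ * f t) (vol T) := by
  refine integrable_bdd_mul (C := (s 0)⁻¹) hf h.measurable.aemeasurable.inv.aestronglyMeasurable
    fun t ht => ?_
  have ht' := Ioo_subset_Icc_self ht
  rw [Real.norm_of_nonneg (inv_nonneg.2 (h.pos' ht').le)]
  exact inv_anti₀ h.pos (h.le_left ht')

end IsFront

theorem isFront_of_deriv_nonneg {T : ℝ} {s : ℝ → ℝ} {K : NNReal}
    (hs : LipschitzOnWith K s (Icc 0 T)) (h0 : 0 < s 0)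
    (hd : ∀ᵐ t ∂(vol T), 0 ≤ deriv s t) : IsFront T s K := by
  refine ⟨hs, fun x hx y hy hxy => ?_, h0⟩
  have hac : AbsolutelyContinuousOnInterval s x y := by
    refine LipschitzOnWith.absolutelyContinuousOnInterval (K := K) (hs.mono ?_)
    rw [uIcc_of_le hxy]
    exact Icc_subset_Icc hx.1 hy.2
  rw [← sub_nonneg, ← hac.integral_deriv_eq_sub, intervalIntegral.integral_of_le hxy,
    integral_Ioc_eq_integral_Ioo]
  exact integral_nonneg_of_ae
    (ae_mono (Measure.restrict_mono (Ioo_subset_Ioo hx.1 hy.2) le_rfl) hd)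

theorem IsFront.integral_pairing_ge {T : ℝ} {s : ℝ → ℝ} {K : NNReal} (hs : IsFront T s K)
    {E G : Type*} [NormedAddCommGroup E] [NormedSpace ℝ E]
    [NormedAddCommGroup G] [InnerProductSpace ℝ G] (ι : E →L[ℝ] G) (hT : 0 < T)
    {Z : ℝ → E} {W' : ℝ → StrongDual ℝ E} {z₀ : G}
    (hZ : MemLp Z 2 (vol T)) (hW' : MemLp W' 2 (vol T))
    (hw : ∀ᵐ t ∂(vol T), ∀ x, ⟪ι (Z t), ι x⟫_ℝ = ⟪z₀, ι x⟫_ℝ + (∫ τ in (0 : ℝ)..t, W' τ) x) :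
    -(s 0 * ‖z₀‖ ^ 2) / 2 - (∫ t in Ioo 0 T, deriv s t * ‖ι (Z t)‖ ^ 2) / 2
      ≤ ∫ t in Ioo 0 T, W' t (s t • Z t) := by
  obtain ⟨r, hr, hrm, hrs, hrd⟩ := exists_lipschitz_extension hT.le hs.lipschitz hs.monotone
  have h0 : r 0 = s 0 := hrs 0 ⟨le_rfl, hT.le⟩
  have h := integral_weighted_pairing_ge ι hT hZ hW' hw hr hrm (h0 ▸ hs.pos.le)
  have e1 : ∫ t in Ioo 0 T, deriv r t * ‖ι (Z t)‖ ^ 2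
      = ∫ t in Ioo 0 T, deriv s t * ‖ι (Z t)‖ ^ 2 :=
    setIntegral_congr_fun measurableSet_Ioo fun t ht => by simp only [hrd t ht]
  have e2 : ∫ t in Ioo 0 T, W' t (r t • Z t) = ∫ t in Ioo 0 T, W' t (s t • Z t) :=
    setIntegral_congr_fun measurableSet_Ioo fun t ht => by
      simp only [hrs t (Ioo_subset_Icc_self ht)]
  rwa [h0, e1, e2] at h

/-! ### The energy inequality for one equation -/

/-- `Z = W - B` is a component of a weak solution after subtraction of its constant boundary value
`B`, as a function with values in `X`. It has the time derivative `W'` in `L²(0,T;X*)` and the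
initial value `z₀`; the relation between them is stated in terms of inner products with elements
of `X`. -/
structure IsShift (T B : ℝ) (W : ℝ → H1) (W' : ℝ → Xdual) (Z : ℝ → X) (z₀ : H) : Prop where
  memLp : MemLp Z 2 (vol T)
  memLp_top : MemLp (fun t => X.toH (Z t)) ⊤ (vol T)
  ae_eq : ∀ᵐ t ∂(vol T), H1.toH (W t) =ᵐ[vol 1] fun y => X.toH (Z t) y + B
  memLp_deriv : MemLp W' 2 (vol T)
  pairing : ∀ᵐ t ∂(vol T), ∀ x : X,
    ⟪X.toH (Z t), X.toH x⟫_ℝ = ⟪z₀, X.toH x⟫_ℝ + (∫ τ in (0 : ℝ)..t, W' τ) x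

theorem IsComponent.exists_isShift {s₀ T : ℝ} {s : ℝ → ℝ} {w : ℝ → ℝ → ℝ} {b w₀ : ℝ → ℝ}
    {W : ℝ → H1} {W' : ℝ → Xdual} (hc : IsComponent s₀ T s w b w₀ W W') {B : ℝ}
    (hb : ∀ t, 0 ≤ t → b t = B) :
    ∃ Z z₀, IsShift T B W W' Z z₀ ∧
      ‖z₀‖ ^ 2 = ∫ y in Ioo (0 : ℝ) 1, (w₀ (s₀ * y) - B) ^ 2 := by
  obtain ⟨Z, hZ, hZb⟩ := hc.boundary
  obtain ⟨a, ha, hW', haW⟩ := hc.time_deriv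
  have hone : ∀ᵐ y ∂(vol 1), Lp.const 2 (vol 1) B y = B := Lp.coeFn_const 2 (vol 1) B
  have hae : ∀ᵐ t ∂(vol T), H1.toH (W t) =ᵐ[vol 1] fun y => X.toH (Z t) y + B := by
    filter_upwards [hc.repr, hZb, ae_restrict_mem measurableSet_Ioo] with t h1 h2 ht
    filter_upwards [h1, h2] with y h3 h4
    rw [h3, h4, hb t ht.1.le]
    ring
  have hsub : ∀ᵐ t ∂(vol T), X.toH (Z t) = H1.toH (W t) - Lp.const 2 (vol 1) B := by
    filter_upwards [hae] with t h
    refine Lp.ext ?_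
    filter_upwards [h, hone, Lp.coeFn_sub (H1.toH (W t)) (Lp.const 2 (vol 1) B)] with y h1 h2 h3
    rw [h3, Pi.sub_apply, h1, h2]
    ring
  refine ⟨Z, a - Lp.const 2 (vol 1) B, ⟨hZ, ?_, hae, hW', ?_⟩, ?_⟩
  · exact (hc.memLp_H.sub (memLp_const (Lp.const 2 (vol 1) B))).ae_eq
      (hsub.mono fun t h => h.symm)
  · filter_upwards [hsub, haW] with t h1 h2 x
    have h3 := congrArg (fun L : Xdual => L x) h2
    have h4 : ⟪H1.toH (W t), X.toH x⟫_ℝ = ⟪a, X.toH x⟫_ℝ + (∫ τ in (0 : ℝ)..t, W' τ) x := h3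
    rw [h1, inner_sub_left, inner_sub_left, h4]
    ring
  · rw [norm_sq_H]
    refine integral_congr_ae ?_
    filter_upwards [ha, hone, Lp.coeFn_sub a (Lp.const 2 (vol 1) B)] with y h1 h2 h3
    rw [h3, Pi.sub_apply, h1, h2]
    ring

theorem memLp_clm_comp {E F : Type*} [NormedAddCommGroup E] [NormedAddCommGroup F]
    [NormedSpace ℝ E] [NormedSpace ℝ F] {T : ℝ} {Z : ℝ → E} (hZ : MemLp Z 2 (vol T))
    (L : E →L[ℝ] F) : MemLp (fun t => L (Z t)) 2 (vol T) :=
  L.comp_memLp' hZ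

/-- The case of `X`, with the normed space instances supplied explicitly because unification does
not find them. -/
theorem X.memLp_clm_comp {T : ℝ} {Z : ℝ → X} (hZ : MemLp Z 2 (vol T)) (L : X →L[ℝ] H) :
    MemLp (fun t => L (Z t)) 2 (vol T) :=
  @Carbonation.memLp_clm_comp X H inferInstance inferInstance inferInstance inferInstance T Z hZ L

theorem X.memLp_trace {T : ℝ} {Z : ℝ → X} (hZ : MemLp Z 2 (vol T)) :
    MemLp (fun t => H1.rep (Z t) 1) 2 (vol T) := by
  have h := Carbonation.memLp_clm_comp (X.memLp_clm_comp hZ (H1.dy.comp X.subtypeL))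
    (innerSL ℝ oneH)
  exact h.ae_eq (Eventually.of_forall fun t => (X.trace_eq_inner (Z t)).symm)

/-- The energy inequality for one equation with the source term `Φ`, obtained from the test function
`s Z`. The terms `s' ‖Z‖²/2` from the time derivative and from the convection term cancel, and half
of the boundary term `s' z(·,1)²` is taken up by the convection term. The integrability of the
integrand is part of the conclusion. -/
theorem IsShift.energy {T B : ℝ} {W : ℝ → H1} {W' : ℝ → Xdual} {Z : ℝ → X} {z₀ : H}
    (hS : IsShift T B W W' Z z₀) {s : ℝ → ℝ} {K : NNReal} (hs : IsFront T s K) (hT : 0 < T)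
    {κ m : ℝ} {q : ℝ → ℝ} {F : ℝ → ℝ → ℝ} {Φ : ℝ → H} (hwf : WeakForm κ T s W W' q F)
    (hq : ∀ᵐ t ∂(vol T), q t = H1.rep (Z t) 1 + m)
    (hΦ : MemLp Φ 2 (vol T)) (hF : ∀ᵐ t ∂(vol T), F t =ᵐ[vol 1] Φ t) :
    Integrable (fun t => κ * ((s t)⁻¹ * ‖H1.dy (Z t : H1)‖ ^ 2)
        + deriv s t * (H1.rep (Z t) 1 ^ 2 / 2 + m * H1.rep (Z t) 1)
        - s t * ⟪Φ t, X.toH (Z t)⟫_ℝ) (vol T) ∧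
    ∫ t in Ioo 0 T, (κ * ((s t)⁻¹ * ‖H1.dy (Z t : H1)‖ ^ 2)
        + deriv s t * (H1.rep (Z t) 1 ^ 2 / 2 + m * H1.rep (Z t) 1)
        - s t * ⟪Φ t, X.toH (Z t)⟫_ℝ)
      ≤ s 0 * ‖z₀‖ ^ 2 / 2 := by
  set a : ℝ → ℝ := fun t => H1.rep (Z t) 1 with ha
  have hdyL : MemLp (fun t => H1.dy (Z t : H1)) 2 (vol T) :=
    X.memLp_clm_comp hS.memLp (H1.dy.comp X.subtypeL)
  have hιL : MemLp (fun t => X.toH (Z t)) 2 (vol T) := X.memLp_clm_comp hS.memLp X.toH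
  have haL : MemLp a 2 (vol T) := X.memLp_trace hS.memLp
  have hdy2 : Integrable (fun t => ‖H1.dy (Z t : H1)‖ ^ 2) (vol T) :=
    hdyL.integrable_norm_pow two_ne_zero
  have hι2 : Integrable (fun t => ‖X.toH (Z t)‖ ^ 2) (vol T) :=
    hιL.integrable_norm_pow two_ne_zero
  have ha2 : Integrable (fun t => a t ^ 2) (vol T) := haL.integrable_sq
  have ha1 : Integrable a (vol T) := haL.integrable one_le_two
  have hi1 : Integrable (fun t => κ * ((s t)⁻¹ * ‖H1.dy (Z t : H1)‖ ^ 2)) (vol T) :=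
    (hs.integrable_inv_mul hdy2).const_mul κ
  have hi2 : Integrable (fun t => deriv s t * (a t ^ 2 / 2 + m * a t)) (vol T) :=
    hs.integrable_deriv_mul ((ha2.div_const 2).add (ha1.const_mul m))
  have hi3 : Integrable (fun t => s t * ⟪Φ t, X.toH (Z t)⟫_ℝ) (vol T) :=
    hs.integrable_mul (memLp_inner hΦ hιL)
  have hi4 : Integrable (fun t => deriv s t * (a t ^ 2 + m * a t)) (vol T) :=
    hs.integrable_deriv_mul (ha2.add (ha1.const_mul m))
  have hi5 : Integrable (fun t => deriv s t * ((a t ^ 2 - ‖X.toH (Z t)‖ ^ 2) / 2)) (vol T) :=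
    hs.integrable_deriv_mul ((ha2.sub hι2).div_const 2)
  have hi6 : Integrable (fun t => deriv s t * ‖X.toH (Z t)‖ ^ 2) (vol T) :=
    hs.integrable_deriv_mul hι2
  refine ⟨(hi1.add hi2).sub hi3, ?_⟩
  have hY : MemLp (fun t => s t • Z t) 2 (vol T) := by
    refine hS.memLp.of_le_mul (c := s T)
      (hs.measurable.smul hS.memLp.aestronglyMeasurable) ?_
    filter_upwards [ae_restrict_mem measurableSet_Ioo] with t ht
    rw [norm_smul]
    exact mul_le_mul_of_nonneg_right (hs.norm_le t ht) (norm_nonneg _)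
  have hYtop : MemLp (fun t => X.toH (s t • Z t)) ⊤ (vol T) := by
    refine hS.memLp_top.of_le_mul (c := s T)
      (X.toH.continuous.comp_aestronglyMeasurable hY.aestronglyMeasurable) ?_
    filter_upwards [ae_restrict_mem measurableSet_Ioo] with t ht
    rw [map_smul, norm_smul]
    exact mul_le_mul_of_nonneg_right (hs.norm_le t ht) (norm_nonneg _)
  have hweak := hwf _ hY hYtop
  have e2 : ∫ t in Ioo 0 T, ∫ y in Ioo (0 : ℝ) 1,
        κ / s t ^ 2 * H1.dy (W t) y * H1.dy ((s t • Z t : X) : H1) y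
      = ∫ t in Ioo 0 T, κ * ((s t)⁻¹ * ‖H1.dy (Z t : H1)‖ ^ 2) := by
    refine integral_congr_ae ?_
    filter_upwards [hS.ae_eq, ae_restrict_mem measurableSet_Ioo] with t h1 ht
    have hst := (hs.pos' (Ioo_subset_Icc_self ht)).ne'
    have h2 : H1.dy (W t) = H1.dy (Z t : H1) := H1.dy_eq_of_ae_add_const h1
    have h3 : H1.dy ((s t • Z t : X) : H1) = s t • H1.dy (Z t : H1) :=
      map_smul H1.dy (s t) (Z t : H1)
    rw [h2, h3, norm_sq_H, ← integral_const_mul, ← integral_const_mul]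
    refine integral_congr_ae ?_
    filter_upwards [Lp.coeFn_smul (s t) (H1.dy (Z t : H1))] with y hy
    rw [hy, Pi.smul_apply, smul_eq_mul]
    field_simp
  have e3 : ∫ t in Ioo 0 T, deriv s t / s t * q t * H1.rep (s t • Z t : X) 1
      = ∫ t in Ioo 0 T, deriv s t * (a t ^ 2 + m * a t) := by
    refine integral_congr_ae ?_
    filter_upwards [hq, ae_restrict_mem measurableSet_Ioo] with t h1 ht
    have hst := (hs.pos' (Ioo_subset_Icc_self ht)).ne'
    rw [h1, X.trace_smul]
    simp only [ha]
    field_simp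
  have e4 : ∫ t in Ioo 0 T, ∫ y in Ioo (0 : ℝ) 1,
        (F t y + deriv s t / s t * y * H1.dy (W t) y) * X.toH (s t • Z t) y
      = ∫ t in Ioo 0 T, (s t * ⟪Φ t, X.toH (Z t)⟫_ℝ
          + deriv s t * ((a t ^ 2 - ‖X.toH (Z t)‖ ^ 2) / 2)) := by
    refine integral_congr_ae ?_
    filter_upwards [hS.ae_eq, hF, ae_restrict_mem measurableSet_Ioo] with t h1 hFt ht
    have hst := (hs.pos' (Ioo_subset_Icc_self ht)).ne'
    have h2 : H1.dy (W t) = H1.dy (Z t : H1) := H1.dy_eq_of_ae_add_const h1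
    have h3 := H1.integral_y_mul_dy_mul (Z t : H1)
    have h4 : H1.toH (Z t : H1) = X.toH (Z t) := rfl
    rw [h4] at h3
    have hI1 : Integrable (fun y => s t * (Φ t y * X.toH (Z t) y)) (vol 1) :=
      (integrable_mul_H _ _).const_mul _
    have hI2 : Integrable (fun y => deriv s t * (y * H1.dy (Z t : H1) y * X.toH (Z t) y))
        (vol 1) := by
      refine Integrable.const_mul ?_ _
      simp only [mul_assoc]
      exact integrable_bdd_mul (C := 1) (integrable_mul_H _ _) measurable_id'.aestronglyMeasurable
        fun y hy => by rw [Real.norm_of_nonneg hy.1.le]; exact hy.2.le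
    simp only [ha]
    rw [h2, ← h3, inner_H, ← integral_const_mul, ← integral_const_mul, ← integral_add hI1 hI2]
    refine integral_congr_ae ?_
    filter_upwards [hFt, Lp.coeFn_smul (s t) (X.toH (Z t))] with y h5 h6
    rw [h5, map_smul, h6, Pi.smul_apply, smul_eq_mul]
    field_simp
  rw [e2, e3, e4, integral_add hi3 hi5] at hweak
  have hpair := @IsFront.integral_pairing_ge T s K hs X H inferInstance inferInstance inferInstance
    inferInstance X.toH hT Z W' z₀ hS.memLp hS.memLp_deriv hS.pairing
  have e5 : ∫ t in Ioo 0 T, deriv s t * (a t ^ 2 / 2 + m * a t)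
      = (∫ t in Ioo 0 T, deriv s t * (a t ^ 2 + m * a t))
        - (∫ t in Ioo 0 T, deriv s t * ((a t ^ 2 - ‖X.toH (Z t)‖ ^ 2) / 2))
        - (∫ t in Ioo 0 T, deriv s t * ‖X.toH (Z t)‖ ^ 2) / 2 := by
    rw [← integral_div, ← integral_sub hi4 hi5, ← integral_sub ?_ (hi6.div_const 2)]
    · congr 1
      ext t
      ring
    · exact hi4.sub hi5
  rw [integral_sub ?_ hi3, integral_add hi1 hi2, e5]
  · linarith
  · exact hi1.add hi2

/-! ### The energy inequality for the coupled system -/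

theorem IsShift.rep_one {T B : ℝ} {W : ℝ → H1} {W' : ℝ → Xdual} {Z : ℝ → X} {z₀ : H}
    (hS : IsShift T B W W' Z z₀) : ∀ᵐ t ∂(vol T), H1.rep (W t) 1 = H1.rep (Z t) 1 + B := by
  filter_upwards [hS.ae_eq] with t h
  exact H1.rep_eq_of_ae_add_const (z := (Z t : H1)) h 1 (right_mem_Icc.2 zero_le_one)

/-- Since `γ h = g`, Henry's law has the same form for the deviations `z` and `ζ` from `g` and
`h`. -/
theorem exchange_ae_eq {P : Problem} {g h : ℝ} (hgh : P.γ * h = g) {a b : ℝ → ℝ} {U V z ζ : H}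
    (hUa : U =ᵐ[vol 1] a) (hVb : V =ᵐ[vol 1] b) (hU : U =ᵐ[vol 1] fun y => z y + g)
    (hV : V =ᵐ[vol 1] fun y => ζ y + h) :
    (fun y => P.f (a y) (b y)) =ᵐ[vol 1] (P.β • (P.γ • ζ - z) : H) := by
  filter_upwards [hUa, hVb, hU, hV, Lp.coeFn_smul P.β (P.γ • ζ - z), Lp.coeFn_sub (P.γ • ζ) z,
    Lp.coeFn_smul P.γ ζ] with y h1 h2 h3 h4 h5 h6 h7
  rw [h5, Pi.smul_apply, h6, Pi.sub_apply, h7, Pi.smul_apply, ← h1, ← h2, h3, h4]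
  simp only [smul_eq_mul, Problem.f, ← hgh]
  ring

theorem Problem.ψ_nonneg {P : Problem} (hα : 0 < P.α) (r : ℝ) : 0 ≤ P.ψ r :=
  mul_nonneg hα.le (Real.rpow_nonneg (le_max_right _ _) _)

/-- The boundary term of the first equation. Where `a + g ≤ 0` the rate vanishes; elsewhere
`a²/2 + (g + 1) a = (a + g)²/2 + (a + g) - g²/2 - g`. -/
theorem Problem.ψ_mul_ge {P : Problem} (hα : 0 < P.α) (hp : 1 ≤ P.p) (g a : ℝ) :
    -(P.ψ (a + g) * (g ^ 2 / 2 + g)) ≤ P.ψ (a + g) * (a ^ 2 / 2 + (g + 1) * a) := by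
  rcases le_or_gt (a + g) 0 with h | h
  · have h0 : P.ψ (a + g) = 0 := by
      rw [Problem.ψ, max_eq_right h, Real.zero_rpow (by linarith), mul_zero]
    simp [h0]
  · have := mul_nonneg (Problem.ψ_nonneg hα (a + g))
      (by positivity : 0 ≤ (a + g) ^ 2 / 2 + (a + g))
    linarith

/-- If `u = a + g` is close to `g`, the rate `ψ(u)` is not small; otherwise `a²/g` is not small. The
proof bounds `g` by `[u]⁺ + |a|` and uses `r ≤ g/2 + (g/2)^(1-p) r^p`, which holds because
`p ≥ 1`. -/
theorem Problem.quarter_le {P : Problem} (hα : 0 < P.α) (hp : 1 ≤ P.p) {g : ℝ} (hg : 0 < g)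
    (a : ℝ) : g / 4 ≤ (g / 2) ^ (1 - P.p) / P.α * P.ψ (a + g) + a ^ 2 / g := by
  set r := max (a + g) 0 with hr
  have h1 : r ≤ g / 2 + (g / 2) ^ (1 - P.p) * r ^ P.p := by
    rcases le_or_gt r (g / 2) with h | h
    · have : 0 ≤ (g / 2) ^ (1 - P.p) * r ^ P.p := by
        have : 0 ≤ r := le_max_right _ _
        positivity
      linarith
    · have hr0 : 0 < r := (by positivity : 0 < g / 2).trans h
      have h2 : r ^ (1 - P.p) ≤ (g / 2) ^ (1 - P.p) :=
        Real.rpow_le_rpow_of_nonpos (by positivity) h.le (by linarith)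
      have h3 : r ^ (1 - P.p) * r ^ P.p = r := by
        rw [← Real.rpow_add hr0]; simp
      have h4 := mul_le_mul_of_nonneg_right h2 (by positivity : 0 ≤ r ^ P.p)
      linarith [half_pos hg]
  have h2 : (g / 2) ^ (1 - P.p) / P.α * P.ψ (a + g) = (g / 2) ^ (1 - P.p) * r ^ P.p := by
    rw [Problem.ψ, ← hr]
    field_simp
  have h3 : -a ≤ g / 4 + a ^ 2 / g := by
    have : 0 ≤ (a + g / 2) ^ 2 / g := by positivity
    have e : (a + g / 2) ^ 2 / g = a ^ 2 / g + a + g / 4 := by field_simp; ring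
    linarith
  have h4 : a + g ≤ r := le_max_left _ _
  rw [h2]
  linarith

/-- The energy inequality for the system, in terms of the trace `a(t) = u(t,s(t)) - g` only. The
right-hand side depends on the data and on `s(T)`. -/
theorem Problem.IsWeakSolutionOn.exists_trace {P : Problem} {T : ℝ} {s : ℝ → ℝ}
    {u v : ℝ → ℝ → ℝ} (hsol : P.IsWeakSolutionOn T s u v) (hT : 0 < T)
    (hκ₁ : 0 < P.κ₁) (hκ₂ : 0 < P.κ₂) (hα : 0 < P.α) (hp : 1 ≤ P.p)
    (hβ : 0 < P.β) (hγ : 0 < P.γ) (hs₀ : 0 < P.s₀) {g h : ℝ} (hgh : P.γ * h = g)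
    (hg : ∀ t, 0 ≤ t → P.g t = g) (hh : ∀ t, 0 ≤ t → P.h t = h) :
    ∃ (a : ℝ → ℝ) (K : NNReal), IsFront T s K ∧ s 0 = P.s₀ ∧
      Integrable (fun t => a t ^ 2) (vol T) ∧
      (∀ᵐ t ∂(vol T), deriv s t = P.ψ (a t + g)) ∧
      P.κ₁ / s T * ∫ t in Ioo 0 T, a t ^ 2
        ≤ P.s₀ / 2 * ((∫ y in Ioo (0 : ℝ) 1, (P.u₀ (P.s₀ * y) - g) ^ 2)
            + P.γ * ∫ y in Ioo (0 : ℝ) 1, (P.v₀ (P.s₀ * y) - h) ^ 2)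
          + (g ^ 2 / 2 + g + P.γ * (h ^ 2 / 2)) * (s T - P.s₀) := by
  obtain ⟨U, V, U', V', ⟨K, hK⟩, -, hU, hV, hd, hs0, hwu, hwv⟩ := hsol
  obtain ⟨Z, z₀, hZ, hz₀⟩ := hU.exists_isShift hg
  obtain ⟨Y, y₀, hY, hy₀⟩ := hV.exists_isShift hh
  set a : ℝ → ℝ := fun t => H1.rep (Z t) 1 with ha
  have hd' : ∀ᵐ t ∂(vol T), deriv s t = P.ψ (a t + g) := by
    filter_upwards [hd, hZ.rep_one] with t h1 h2
    rw [h1, h2]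
  have hs : IsFront T s K := isFront_of_deriv_nonneg hK (hs0 ▸ hs₀)
    (hd'.mono fun t ht => ht ▸ Problem.ψ_nonneg hα _)
  have hZL := X.memLp_clm_comp hZ.memLp X.toH
  have hYL := X.memLp_clm_comp hY.memLp X.toH
  have ha2 : Integrable (fun t => a t ^ 2) (vol T) := (X.memLp_trace hZ.memLp).integrable_sq
  refine ⟨a, K, hs, hs0, ha2, hd', ?_⟩
  set Φ : ℝ → H := fun t => P.β • (P.γ • X.toH (Y t) - X.toH (Z t)) with hΦ
  have hΦL : MemLp Φ 2 (vol T) := ((hYL.const_smul P.γ).sub hZL).const_smul P.β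
  have hF : ∀ᵐ t ∂(vol T), (fun y => P.f (bar s u t y) (bar s v t y)) =ᵐ[vol 1] Φ t := by
    filter_upwards [hU.repr, hV.repr, hZ.ae_eq, hY.ae_eq] with t h1 h2 h3 h4
    exact exchange_ae_eq hgh h1 h2 h3 h4
  have hF' : ∀ᵐ t ∂(vol T),
      (fun y => -P.f (bar s u t y) (bar s v t y)) =ᵐ[vol 1] (-Φ) t := by
    filter_upwards [hF] with t h1
    filter_upwards [h1, Lp.coeFn_neg (Φ t)] with y h2 h3
    rw [Pi.neg_apply, h3, Pi.neg_apply, h2]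
  obtain ⟨hi1, he1⟩ := hZ.energy hs hT (m := g + 1) hwu
    (hZ.rep_one.mono fun t ht => by rw [ht]; ring) hΦL hF
  obtain ⟨hi2, he2⟩ := hY.energy hs hT (m := h) hwv hY.rep_one hΦL.neg hF'
  have hi3 : Integrable (fun t => deriv s t * (g ^ 2 / 2 + g + P.γ * (h ^ 2 / 2))) (vol T) :=
    hs.integrable_deriv_mul (integrable_const _)
  have hmono := integral_mono_ae ((ha2.const_mul (P.κ₁ / s T)).sub hi3)
    (hi1.add (hi2.const_mul P.γ)) ?_
  · simp only [Pi.sub_apply, Pi.add_apply] at hmono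
    rw [integral_sub (ha2.const_mul _) hi3, integral_add hi1 (hi2.const_mul _),
      integral_const_mul, integral_const_mul, integral_mul_const, hs.integral_deriv hT.le,
      hs0] at hmono
    rw [hs0, hz₀] at he1
    rw [hs0, hy₀] at he2
    have := mul_le_mul_of_nonneg_left he2 hγ.le
    linarith
  · filter_upwards [hd', ae_restrict_mem measurableSet_Ioo] with t hdt ht
    have ht' := Ioo_subset_Icc_self ht
    have hst := hs.pos' ht'
    simp only [Pi.sub_apply, Pi.add_apply, Pi.neg_apply]
    have b1 : P.κ₁ / s T * a t ^ 2 ≤ P.κ₁ * ((s t)⁻¹ * ‖H1.dy (Z t : H1)‖ ^ 2) := by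
      rw [div_eq_mul_inv, mul_assoc]
      refine mul_le_mul_of_nonneg_left ?_ hκ₁.le
      exact mul_le_mul (inv_anti₀ hst (hs.le_right ht')) (X.trace_sq_le _) (sq_nonneg _)
        (inv_nonneg.2 hst.le)
    have b2 : 0 ≤ P.κ₂ * ((s t)⁻¹ * ‖H1.dy (Y t : H1)‖ ^ 2) := by positivity
    have b3 := Problem.ψ_mul_ge hα hp g (a t)
    rw [← hdt] at b3
    have hdn : 0 ≤ deriv s t := hdt ▸ Problem.ψ_nonneg hα _
    have b4 : -(deriv s t * (h ^ 2 / 2))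
        ≤ deriv s t * (H1.rep (Y t) 1 ^ 2 / 2 + h * H1.rep (Y t) 1) := by
      have := mul_nonneg hdn (by positivity : 0 ≤ (H1.rep (Y t) 1 + h) ^ 2 / 2)
      linarith
    -- The two source terms add up to `s β ‖γ ζ - z‖²`.
    have b5 : 0 ≤ s t * (P.γ * ⟪Φ t, X.toH (Y t)⟫_ℝ - ⟪Φ t, X.toH (Z t)⟫_ℝ) := by
      refine mul_nonneg hst.le ?_
      rw [← inner_smul_right, ← inner_sub_right, hΦ, inner_smul_left]
      exact mul_nonneg hβ.le real_inner_self_nonneg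
    have b6 := mul_le_mul_of_nonneg_left b4 hγ.le
    have b7 := mul_nonneg hγ.le b2
    rw [inner_neg_left]
    simp only [ha] at b1 b3 ⊢
    linarith

/-! ### The square-root law -/

/-- The elementary conclusion: all terms on the right of the two hypotheses are at most quadratic in
`S`, since `S ≥ s₀ > 0`. -/
theorem le_mul_sq_of_front {T S s₀ κ g L E C : ℝ} (hS : s₀ ≤ S) (hs₀ : 0 < s₀) (hκ : 0 < κ)
    (hg : 0 < g) (hL : 0 ≤ L) (hE : 0 ≤ E) (hC : 0 ≤ C) {I : ℝ}
    (hI : κ / S * I ≤ E + C * (S - s₀)) (hT : g / 4 * T ≤ L * (S - s₀) + I / g) :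
    T ≤ 4 / g * (L / s₀ + (E / s₀ + C) / (κ * g)) * S ^ 2 := by
  have hSpos : 0 < S := hs₀.trans_le hS
  have h1 : S ≤ S ^ 2 / s₀ := by
    rw [le_div_iff₀ hs₀, sq]
    exact mul_le_mul_of_nonneg_left hS hSpos.le
  have h2 : E ≤ E / s₀ * S := by
    rw [div_mul_eq_mul_div, le_div_iff₀ hs₀]
    exact mul_le_mul_of_nonneg_left hS hE
  have h3 : I ≤ (E / s₀ + C) / κ * S ^ 2 := by
    have h4 : κ / S * I ≤ (E / s₀ + C) * S := by
      have := mul_nonneg hC hs₀.le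
      linarith
    have e : I = S / κ * (κ / S * I) := by field_simp
    rw [e]
    refine (mul_le_mul_of_nonneg_left h4 (by positivity)).trans (le_of_eq ?_)
    field_simp
  have h5 : L * (S - s₀) ≤ L / s₀ * S ^ 2 := by
    have := mul_le_mul_of_nonneg_left h1 hL
    have e : L / s₀ * S ^ 2 = L * (S ^ 2 / s₀) := by ring
    have := mul_nonneg hL hs₀.le
    linarith
  have h6 : I / g ≤ (E / s₀ + C) / (κ * g) * S ^ 2 := by
    refine (div_le_div_of_nonneg_right h3 hg.le).trans (le_of_eq ?_)
    field_simp
  have h7 : T = 4 / g * (g / 4 * T) := by field_simp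
  rw [h7, mul_assoc]
  refine mul_le_mul_of_nonneg_left ?_ (by positivity)
  linarith

end Carbonation

theorem theorem2p3 (P : Carbonation.Problem)
    (hκ₁ : 0 < P.κ₁) (hκ₂ : 0 < P.κ₂) (hα : 0 < P.α) (hp : 1 ≤ P.p)
    (hβ : 0 < P.β) (hγ : 0 < P.γ) (hs₀ : 0 < P.s₀)
    (gStar hStar : ℝ) (hgStar : 0 < gStar) (hhStar : 0 < hStar) (hgh : P.γ * hStar = gStar)
    (hg : ∀ t, 0 ≤ t → P.g t = gStar) (hh : ∀ t, 0 ≤ t → P.h t = hStar)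
    (hu₀ : Carbonation.IsInitialDatum P.s₀ P.u₀) (hv₀ : Carbonation.IsInitialDatum P.s₀ P.v₀) :
    ∃ c : ℝ, 0 < c ∧ ∀ (s : ℝ → ℝ) (u v : ℝ → ℝ → ℝ), P.IsWeakSolution s u v →
      ∀ t : ℝ, 0 ≤ t → c * √t ≤ s t := by
  set L : ℝ := (gStar / 2) ^ (1 - P.p) / P.α
  set E : ℝ := P.s₀ / 2 * ((∫ y in Ioo (0 : ℝ) 1, (P.u₀ (P.s₀ * y) - gStar) ^ 2)
    + P.γ * ∫ y in Ioo (0 : ℝ) 1, (P.v₀ (P.s₀ * y) - hStar) ^ 2)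
  set C : ℝ := gStar ^ 2 / 2 + gStar + P.γ * (hStar ^ 2 / 2)
  have hL : 0 < L := by positivity
  have hE : 0 ≤ E := mul_nonneg (by positivity) (add_nonneg
    (integral_nonneg fun y => sq_nonneg _)
    (mul_nonneg hγ.le (integral_nonneg fun y => sq_nonneg _)))
  have hC : 0 ≤ C := by positivity
  set M : ℝ := 4 / gStar * (L / P.s₀ + (E / P.s₀ + C) / (P.κ₁ * gStar))
  have hMpos : 0 < M := by positivity
  refine ⟨(√M)⁻¹, by positivity, fun s u v hsol t ht => ?_⟩
  rcases ht.eq_or_lt with rfl | htpos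
  -- At time zero only `0 ≤ s 0` is claimed; any weak solution on a positive time interval gives it.
  · obtain ⟨-, -, -, -, -, hpos, -⟩ := hsol 1 one_pos
    simpa using (hpos 0 ⟨le_rfl, zero_le_one⟩).le
  obtain ⟨a, K, hs, hs0, ha2, hd, hen⟩ :=
    (hsol t htpos).exists_trace htpos hκ₁ hκ₂ hα hp hβ hγ hs₀ hgh hg hh
  have hti : t ∈ Icc 0 t := ⟨ht, le_rfl⟩
  have hdi : Integrable (deriv s) (Carbonation.vol t) := by
    simpa using hs.integrable_deriv_mul (integrable_const (1 : ℝ))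
  have hlow : gStar / 4 * t ≤ L * (s t - P.s₀) + (∫ τ in Ioo 0 t, a τ ^ 2) / gStar := by
    have h := integral_mono_ae (μ := Carbonation.vol t) (integrable_const (gStar / 4))
      ((hdi.const_mul L).add (ha2.div_const gStar)) ?_
    · simp only [Pi.add_apply] at h
      have e : ∫ _ in Ioo 0 t, gStar / 4 = gStar / 4 * t := by simp [ht, mul_comm]
      rwa [e, integral_add (hdi.const_mul L) (ha2.div_const gStar), integral_const_mul,
        integral_div, hs.integral_deriv ht, hs0] at h
    · filter_upwards [hd] with τ hτ
      simp only [Pi.add_apply, hτ]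
      exact Carbonation.Problem.quarter_le hα hp hgStar (a τ)
  have hmain : t ≤ M * s t ^ 2 :=
    Carbonation.le_mul_sq_of_front (hs0 ▸ hs.le_left hti) hs₀ hκ₁ hgStar
      hL.le hE hC hen hlow
  rw [inv_mul_le_iff₀ (by positivity)]
  calc √t ≤ √(M * s t ^ 2) := Real.sqrt_le_sqrt hmain
    _ = √M * s t := by rw [Real.sqrt_mul hMpos.le, Real.sqrt_sq (hs.pos' hti).le]
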